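/- All vector spaces are complex and finite-dimensional. A \emph{quadratic Lie superalgebra} $(\mathfrak g,B)$ is a Lie superalgebra $\mathfrak g=\mathfrak g_{\bar 0}\oplus\mathfrak g_{\bar 1}$ with a non-degenerate bilinear form $B$ that is even ($B(\mathfrak g_{\bar 0},\mathfrak g_{\bar 1})=0$), supersymmetric ($B(X,Y)=(-1)^{xy}B(Y,X)$ for homogeneous $X,Y$ of parities $x,y$) and invariant ($B([X,Y],Z)=B(X,[Y,Z])$). Two such algebras are \emph{i-isomorphic} if there is an (even) isomorphism of Lie superalgebras between them that preserves the forms. $(\mathfrak g,B)$ is \emph{reduced} if $\mathfrak g\neq 0$ and its center is totally isotropic. Let $\mathscr E(\mathfrak g)=\operatorname{Alt}(\mathfrak g_{\bar 0})\otimes\operatorname{Sym}(\mathfrak g_{\bar 1})$ be the super-exterior algebra of $\mathfrak g^*$, identified with the algebra of super-antisymmetric multilinear forms on $\mathfrak g$, with product $\wedge$, and let $I(X,Y,Z)=B([X,Y],Z)$. $(\mathfrak g,B)$ is \emph{elementary} if $I$ is decomposable, i.e. $I=\alpha\wedge\beta\wedge\gamma$ for some $\alpha,\beta,\gamma\in\mathfrak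 g^*$. A non-Abelian $(\mathfrak g,B)$ is \emph{singular of type $\mathsf S_3$} if $\dim\{\alpha\in\mathfrak g^*\mid\alpha\wedge I=0\}=3$. \textbf{Proposition.} Every reduced elementary quadratic Lie superalgebra is i-isomorphic to exactly one member of the following list. (Brackets and values of $B$ that are not given, and do not follow by super-antisymmetry, respectively supersymmetry, are zero.) (1) Quadratic Lie algebras (zero odd part): \begin{itemize} \item $\mathfrak g_3(\lambda)$, $\lambda\in\mathbb C\setminus\{0\}$: the Lie algebra $\mathfrak o(3)$ with basis $e_1,e_2,e_3$, $[e_1,e_2]=e_3$, $[e_2,e_3]=e_1$, $[e_3,e_1]=e_2$, $B(e_i,e_i)=\lambda$; \item $\mathfrak g_4$: basis $X,P,Q,Z$, $[X,P]=P$, $[X,Q]=-Q$, $[P,Q]=Z$, $B(X,Z)=B(P,Q)=1$; \item $\mathfrak g_5$: basis $X_1,X_2,T,Z_1,Z_2$, $[X_1,X_2]=T$, $[X_1,T]=-Z_2$, $[X_2,T]=Z_1$, $B(X_1,Z_1)=B(X_2,Z_2)=B(T,T)=1$; \item $\mathfrak g_6$: basis $X_1,X_2,X_3,Z_1,Z_2,Z_3$,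 $[X_1,X_2]=Z_3$, $[X_2,X_3]=Z_1$, $[X_3,X_1]=Z_2$, $B(X_i,Z_i)=1$ for $i=1,2,3$. \end{itemize} (2) $\mathfrak g^s_{4,1}$: even basis $X_{\bar 0},Y_{\bar 0}$, odd basis $X_{\bar 1},Z_{\bar 1}$, $B(X_{\bar 0},Y_{\bar 0})=B(X_{\bar 1},Z_{\bar 1})=1$, $[Z_{\bar 1},Z_{\bar 1}]=-2X_{\bar 0}$, $[Y_{\bar 0},Z_{\bar 1}]=-2X_{\bar 1}$. (3) $\mathfrak g^s_{4,2}$: even basis $X_{\bar 0},Y_{\bar 0}$, odd basis $X_{\bar 1},Y_{\bar 1}$, $B(X_{\bar 0},Y_{\bar 0})=B(X_{\bar 1},Y_{\bar 1})=1$, $[X_{\bar 1},Y_{\bar 1}]=X_{\bar 0}$, $[Y_{\bar 0},X_{\bar 1}]=X_{\bar 1}$, $[Y_{\bar 0},Y_{\bar 1}]=-Y_{\bar 1}$. (4) $\mathfrak g^s_6$: even basis $X_{\bar 0},Y_{\bar 0}$, odd basis $X_{\bar 1},Y_{\bar 1},Z_{\bar 1},T_{\bar 1}$, $B(X_{\bar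 0},Y_{\bar 0})=B(X_{\bar 1},Z_{\bar 1})=B(Y_{\bar 1},T_{\bar 1})=1$, $[Z_{\bar 1},T_{\bar 1}]=-X_{\bar 0}$, $[Y_{\bar 0},Z_{\bar 1}]=-Y_{\bar 1}$, $[Y_{\bar 0},T_{\bar 1}]=-X_{\bar 1}$. Conversely, every member of the list is a reduced elementary quadratic Lie superalgebra; those in (1) are singular of type $\mathsf S_3$ with zero odd part, and those in (2)--(4) have a 2-dimensional even part. -/

import Mathlib

/-- The sign `(-1)^{ij}` attached to two parities `i, j ∈ ℤ/2ℤ`. -/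
def superSign (i j : ZMod 2) : ℤ := (-1) ^ (i.val * j.val)

/-- A complex Lie superalgebra structure on the vector space `V`: a `ℤ/2ℤ`-gradation
`V = V₀ ⊕ V₁` and an even bilinear super-bracket which is super-antisymmetric and satisfies the
super Jacobi identity. -/
structure LieSuperalgebra (V : Type*) [AddCommGroup V] [Module ℂ V] where
  /-- `part 0` is the even part and `part 1` is the odd part. -/
  part : ZMod 2 → Submodule ℂ V
  isCompl_part : IsCompl (part 0) (part 1)
  bracket : V →ₗ[ℂ] V →ₗ[ℂ] V
  bracket_mem : ∀ i j x y, x ∈ part i → y ∈ part j → bracket x y ∈ part (i + j)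
  bracket_skew : ∀ i j x y, x ∈ part i → y ∈ part j →
    bracket x y = -(superSign i j • bracket y x)
  jacobi : ∀ i j x y z, x ∈ part i → y ∈ part j →
    bracket x (bracket y z) = bracket (bracket x y) z + superSign i j • bracket y (bracket x z)

/-- A quadratic Lie superalgebra structure on `V`: a Lie superalgebra structure together with a
non-degenerate even supersymmetric invariant bilinear form. -/
structure QuadraticLieSuperalgebra (V : Type*) [AddCommGroup V] [Module ℂ V] extends
    LieSuperalgebra V where
  form : LinearMap.BilinForm ℂ V
  form_nondegenerate : form.Nondegenerate
  form_even : ∀ x y, x ∈ part 0 → y ∈ part 1 → form x y = 0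
  form_supersymm : ∀ i j x y, x ∈ part i → y ∈ part j → form x y = superSign i j • form y x
  form_invariant : ∀ x y z, form (bracket x y) z = form x (bracket y z)

namespace LieSuperalgebra

variable {V : Type*} [AddCommGroup V] [Module ℂ V]

/-- The centre. -/
def center (g : LieSuperalgebra V) : Submodule ℂ V := LinearMap.ker g.bracket

/-- The projection of `V` onto its even part, along the odd part. -/
noncomputable def evenProj (g : LieSuperalgebra V) : V →ₗ[ℂ] V :=
  Submodule.projection _ _ g.isCompl_part

/-- The projection of `V` onto its odd part, along the even part. -/
noncomputable def oddProj (g : LieSuperalgebra V) : V →ₗ[ℂ] V :=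
  Submodule.projection _ _ g.isCompl_part.symm

/-- The parity involution: the identity on the even part, minus the identity on the odd part. -/
noncomputable def parityInv (g : LieSuperalgebra V) : V →ₗ[ℂ] V := g.evenProj - g.oddProj

/-- The super-exterior product `α ∧ A` of a linear form and a `k`-linear form. The super-exterior
algebra of `V*` is realised as the algebra of super-antisymmetric multilinear forms. On homogeneous
vectors `X₀, …, X_k` of parities `x₀, …, x_k` the value is
`∑ⱼ (-1)^j (-1)^{xⱼ(x_{j+1} + ⋯ + x_k)} α(Xⱼ) A(X₀, …, X̂ⱼ, …, X_k)`.
The sign `(-1)^{xⱼ(x_{j+1} + ⋯ + x_k)}` appears only for the odd component of `Xⱼ`, and is there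
the effect of applying the parity involution to every `Xᵢ` with `i > j`. -/
noncomputable def wedge (g : LieSuperalgebra V) {k : ℕ} (α : Module.Dual ℂ V)
    (A : (Fin k → V) → ℂ) : (Fin (k + 1) → V) → ℂ := fun X =>
  ∑ j : Fin (k + 1), (-1) ^ (j : ℕ) *
    (α (g.evenProj (X j)) * A (fun i => X (j.succAbove i)) +
      α (g.oddProj (X j)) * A (fun i =>
        if j < j.succAbove i then g.parityInv (X (j.succAbove i)) else X (j.succAbove i)))

end LieSuperalgebra

namespace QuadraticLieSuperalgebra

variable {V : Type*} [AddCommGroup V] [Module ℂ V]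

/-- The associated invariant `I(X, Y, Z) = B([X, Y], Z)`. -/
def invariant (g : QuadraticLieSuperalgebra V) : (Fin 3 → V) → ℂ := fun X =>
  g.form (g.bracket (X 0) (X 1)) (X 2)

/-- `g` is elementary if its associated invariant is decomposable, that is, a super-exterior
product of three linear forms. -/
def IsElementary (g : QuadraticLieSuperalgebra V) : Prop :=
  ∃ α β γ : Module.Dual ℂ V,
    g.invariant = g.wedge α (g.wedge β (fun X : Fin 1 → V => γ (X 0)))

/-- `g` is reduced if it is nonzero and its centre is totally isotropic. -/
def IsReduced (g : QuadraticLieSuperalgebra V) : Prop :=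
  Nontrivial V ∧ ∀ x ∈ g.center, ∀ y ∈ g.center, g.form x y = 0

/-- The space of linear forms `α` with `α ∧ I = 0`. -/
noncomputable def dupSpace (g : QuadraticLieSuperalgebra V) : Submodule ℂ (Module.Dual ℂ V) where
  carrier := {α | g.wedge α g.invariant = 0}
  zero_mem' := by
    funext X
    simp [LieSuperalgebra.wedge]
  add_mem' := by
    intro α β hα hβ
    funext X
    have h : g.wedge (α + β) g.invariant X =
        g.wedge α g.invariant X + g.wedge β g.invariant X := by
      simp only [LieSuperalgebra.wedge, LinearMap.add_apply, ← Finset.sum_add_distrib]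
      exact Finset.sum_congr rfl fun j _ => by ring
    have hα' : g.wedge α g.invariant = 0 := hα
    have hβ' : g.wedge β g.invariant = 0 := hβ
    rw [h, hα', hβ']
    simp
  smul_mem' := by
    intro c α hα
    funext X
    have h : g.wedge (c • α) g.invariant X = c * g.wedge α g.invariant X := by
      simp only [LieSuperalgebra.wedge, LinearMap.smul_apply, smul_eq_mul, Finset.mul_sum]
      exact Finset.sum_congr rfl fun j _ => by ring
    have hα' : g.wedge α g.invariant = 0 := hα
    rw [h, hα']
    simp

/-- The dup-number. -/
noncomputable def dup (g : QuadraticLieSuperalgebra V) : ℕ := Module.finrank ℂ g.dupSpace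

/-- `g` is singular of type `S₃`: it is non-Abelian and its dup-number is `3`. -/
def IsSingularS3 (g : QuadraticLieSuperalgebra V) : Prop := g.bracket ≠ 0 ∧ g.dup = 3

/-- `g` and `h` are i-isomorphic: there is an isometric isomorphism of Lie superalgebras. -/
def IIsomorphic {W : Type*} [AddCommGroup W] [Module ℂ W]
    (g : QuadraticLieSuperalgebra V) (h : QuadraticLieSuperalgebra W) : Prop :=
  ∃ A : V ≃ₗ[ℂ] W,
    (∀ i, (g.part i).map A.toLinearMap = h.part i) ∧
    (∀ x y, A (g.bracket x y) = h.bracket (A x) (A y)) ∧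
    (∀ x y, h.form (A x) (A y) = g.form x y)

/-! ### Quadratic Lie superalgebras given by a table on the standard basis of `ℂⁿ` -/

section Table

variable {n : ℕ}

/-- The homogeneous components of `ℂⁿ` when the basis vector `e_a` has parity `p a`. -/
def tablePart (p : Fin n → ZMod 2) (i : ZMod 2) : Submodule ℂ (Fin n → ℂ) :=
  Submodule.span ℂ {x | ∃ a, p a = i ∧ x = Pi.single a 1}

/-- The coefficient of `e_k` in `[e_i, e_j]`. An entry `(a, b, m, v)` of the list `L` stands for
`[e_a, e_b] = v e_m`; brackets not determined by the list through super-antisymmetry are zero. -/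
def tableBracketCoeff (p : Fin n → ZMod 2) (L : List (Fin n × Fin n × Fin n × ℤ))
    (i j k : Fin n) : ℤ :=
  (L.map fun t =>
    if k = t.2.2.1 then
      if i = t.1 ∧ j = t.2.1 then t.2.2.2
      else if i = t.2.1 ∧ j = t.1 then -(superSign (p i) (p j) * t.2.2.2)
      else 0
    else 0).sum

/-- The value of `B(e_i, e_j)`. An entry `(a, b)` of the list `L` stands for `B(e_a, e_b) = 1`;
values not determined by the list through supersymmetry are zero. -/
def tableFormCoeff (p : Fin n → ZMod 2) (L : List (Fin n × Fin n)) (i j : Fin n) : ℤ :=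
  (L.map fun t =>
    if i = t.1 ∧ j = t.2 then 1
    else if i = t.2 ∧ j = t.1 then superSign (p i) (p j)
    else 0).sum

/-- The bilinear bracket on `ℂⁿ` with `[e_i, e_j] = ∑ₖ c i j k • e_k`. -/
def tableBracket (c : Fin n → Fin n → Fin n → ℤ) :
    (Fin n → ℂ) →ₗ[ℂ] (Fin n → ℂ) →ₗ[ℂ] (Fin n → ℂ) :=
  LinearMap.mk₂ ℂ (fun x y k => ∑ i, ∑ j, x i * y j * (c i j k : ℂ))
    (fun x x' y => by
      funext k
      simp only [Pi.add_apply, add_mul, Finset.sum_add_distrib])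
    (fun r x y => by
      funext k
      simp only [Pi.smul_apply, smul_eq_mul, Finset.mul_sum, mul_assoc])
    (fun x y y' => by
      funext k
      simp only [Pi.add_apply, add_mul, mul_add, Finset.sum_add_distrib])
    (fun r x y => by
      funext k
      simp only [Pi.smul_apply, smul_eq_mul, Finset.mul_sum]
      exact Finset.sum_congr rfl fun i _ => Finset.sum_congr rfl fun j _ => by ring)

/-- The bilinear form on `ℂⁿ` with `B(e_i, e_j) = r * b i j`. -/
def tableForm (r : ℂ) (b : Fin n → Fin n → ℤ) : LinearMap.BilinForm ℂ (Fin n → ℂ) :=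
  LinearMap.mk₂ ℂ (fun x y => ∑ i, ∑ j, x i * y j * (r * (b i j : ℂ)))
    (fun x x' y => by
      simp only [Pi.add_apply, add_mul, Finset.sum_add_distrib])
    (fun r x y => by
      simp only [Pi.smul_apply, smul_eq_mul, Finset.mul_sum, mul_assoc])
    (fun x y y' => by
      simp only [Pi.add_apply, add_mul, mul_add, Finset.sum_add_distrib])
    (fun r x y => by
      simp only [Pi.smul_apply, smul_eq_mul, Finset.mul_sum]
      exact Finset.sum_congr rfl fun i _ => Finset.sum_congr rfl fun j _ => by ring)

theorem tableBracket_single (c : Fin n → Fin n → Fin n → ℤ) (i j : Fin n) :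
    tableBracket c (Pi.single i 1) (Pi.single j 1) =
      ∑ k, (c i j k : ℂ) • (Pi.single k 1 : Fin n → ℂ) := by
  funext l
  simp [tableBracket, LinearMap.mk₂_apply, Pi.single_apply, Finset.sum_apply]

theorem tableForm_single (r : ℂ) (b : Fin n → Fin n → ℤ) (i j : Fin n) :
    tableForm r b (Pi.single i 1) (Pi.single j 1) = r * (b i j : ℂ) := by
  simp [tableForm, LinearMap.mk₂_apply, Pi.single_apply]

theorem tablePart_isCompl (p : Fin n → ZMod 2) : IsCompl (tablePart p 0) (tablePart p 1) := by
  have hz : ∀ i, ∀ x ∈ tablePart p i, ∀ k, p k ≠ i → x k = 0 := by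
    intro i x hx k hk
    induction hx using Submodule.span_induction with
    | mem x h =>
      obtain ⟨a, ha, rfl⟩ := h
      have : k ≠ a := by
        rintro rfl
        exact hk ha
      simp [this]
    | zero => rfl
    | add x y _ _ hx hy => simp [hx, hy]
    | smul r x _ hx => simp [hx]
  constructor
  · rw [Submodule.disjoint_def]
    intro x h0 h1
    funext k
    by_cases hk : p k = 0
    · exact hz 1 x h1 k (by rw [hk]; decide)
    · exact hz 0 x h0 k hk
  · rw [codisjoint_iff, eq_top_iff]
    intro x _
    have hx : x = ∑ a, x a • (Pi.single a 1 : Fin n → ℂ) := by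
      funext l
      simp [Finset.sum_apply, Pi.single_apply]
    rw [hx]
    refine Submodule.sum_mem _ fun a _ => Submodule.smul_mem _ _ ?_
    have h2 : ∀ q : ZMod 2, q = 0 ∨ q = 1 := by decide
    rcases h2 (p a) with h | h
    · exact Submodule.mem_sup_left (Submodule.subset_span ⟨a, h, rfl⟩)
    · exact Submodule.mem_sup_right (Submodule.subset_span ⟨a, h, rfl⟩)

theorem table_ext_span {p : Fin n → ZMod 2} {i : ZMod 2} {W : Type*} [AddCommGroup W]
    [Module ℂ W] {f h : (Fin n → ℂ) →ₗ[ℂ] W}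
    (H : ∀ a, p a = i → f (Pi.single a 1) = h (Pi.single a 1)) :
    ∀ x ∈ tablePart p i, f x = h x := by
  intro x hx
  induction hx using Submodule.span_induction with
  | mem x hx =>
    obtain ⟨a, ha, rfl⟩ := hx
    exact H a ha
  | zero => simp
  | add x y _ _ hx hy => simp [hx, hy]
  | smul r x _ hx => simp [hx]

theorem table_ext {W : Type*} [AddCommGroup W] [Module ℂ W] {f h : (Fin n → ℂ) →ₗ[ℂ] W}
    (H : ∀ a, f (Pi.single a 1) = h (Pi.single a 1)) : f = h :=
  (Pi.basisFun ℂ (Fin n)).ext fun a => by simpa using H a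

/-- The finitely many identities which make a table a quadratic Lie superalgebra. -/
structure TableLaws (p : Fin n → ZMod 2) (c : Fin n → Fin n → Fin n → ℤ)
    (b : Fin n → Fin n → ℤ) : Prop where
  even : ∀ i j k, c i j k ≠ 0 → p k = p i + p j
  skew : ∀ i j k, c i j k = -(superSign (p i) (p j) * c j i k)
  jacobi : ∀ i j k l, ∑ m, c j k m * c i m l =
    ∑ m, c i j m * c m k l + superSign (p i) (p j) * ∑ m, c i k m * c j m l
  form_even : ∀ i j, b i j ≠ 0 → p i = p j
  form_symm : ∀ i j, b i j = superSign (p i) (p j) * b j i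
  invariant : ∀ i j k, ∑ m, c i j m * b m k = ∑ m, c j k m * b i m
  orthogonal : ∀ i j, ∑ m, b m i * b m j = if i = j then 1 else 0

/-- The quadratic Lie superalgebra on `ℂⁿ` with `[e_i, e_j] = ∑ₖ c i j k • e_k` and
`B(e_i, e_j) = r * b i j`, where `e_a` has parity `p a`. -/
def ofTable (p : Fin n → ZMod 2) (c : Fin n → Fin n → Fin n → ℤ) (r : ℂˣ)
    (b : Fin n → Fin n → ℤ) (H : TableLaws p c b) : QuadraticLieSuperalgebra (Fin n → ℂ) where
  part := tablePart p
  isCompl_part := tablePart_isCompl p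
  bracket := tableBracket c
  bracket_mem := by
    intro i j x y hx hy
    have key : ∀ a, p a = i → ∀ y ∈ tablePart p j,
        tableBracket c (Pi.single a 1) y ∈ tablePart p (i + j) := by
      intro a ha y hy
      induction hy using Submodule.span_induction with
      | mem y h =>
        obtain ⟨b', hb, rfl⟩ := h
        rw [tableBracket_single]
        refine Submodule.sum_mem _ fun k _ => ?_
        by_cases hk : c a b' k = 0
        · simp [hk]
        · refine Submodule.smul_mem _ _ (Submodule.subset_span ⟨k, ?_, rfl⟩)
          rw [H.even a b' k hk, ha, hb]
      | zero => simp
      | add x y _ _ hx hy =>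
        rw [map_add]
        exact add_mem hx hy
      | smul r x _ hx =>
        rw [map_smul]
        exact Submodule.smul_mem _ _ hx
    induction hx using Submodule.span_induction with
    | mem x h =>
      obtain ⟨a, ha, rfl⟩ := h
      exact key a ha y hy
    | zero => simp
    | add x y _ _ hx hy =>
      rw [map_add, LinearMap.add_apply]
      exact add_mem hx hy
    | smul r x _ hx =>
      rw [map_smul, LinearMap.smul_apply]
      exact Submodule.smul_mem _ _ hx
  bracket_skew := by
    intro i j x y hx hy
    refine table_ext_span (f := (tableBracket c).flip y)
      (h := -(superSign i j • tableBracket c y)) (fun a ha => ?_) x hx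
    refine table_ext_span (f := tableBracket c (Pi.single a 1))
      (h := -(superSign i j • (tableBracket c).flip (Pi.single a 1))) (fun d hd => ?_) y hy
    simp only [LinearMap.neg_apply, LinearMap.smul_apply, LinearMap.flip_apply,
      tableBracket_single, Finset.smul_sum, ← Finset.sum_neg_distrib]
    refine Finset.sum_congr rfl fun k _ => ?_
    rw [H.skew a d k, ha, hd, ← Int.cast_smul_eq_zsmul ℂ, smul_smul, ← neg_smul]
    push_cast
    rfl
  jacobi := by
    intro i j x y z hx hy
    refine table_ext_span
      (f := (tableBracket c).flip (tableBracket c y z))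
      (h := (tableBracket c).flip z ∘ₗ (tableBracket c).flip y +
        superSign i j • (tableBracket c y ∘ₗ (tableBracket c).flip z)) (fun a ha => ?_) x hx
    refine table_ext_span
      (f := tableBracket c (Pi.single a 1) ∘ₗ (tableBracket c).flip z)
      (h := (tableBracket c).flip z ∘ₗ tableBracket c (Pi.single a 1) +
        superSign i j • (tableBracket c).flip (tableBracket c (Pi.single a 1) z))
      (fun d hd => ?_) y hy
    refine LinearMap.congr_fun (f := tableBracket c (Pi.single a 1) ∘ₗ
        tableBracket c (Pi.single d 1))
      (g := tableBracket c (tableBracket c (Pi.single a 1) (Pi.single d 1)) +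
        superSign i j • (tableBracket c (Pi.single d 1) ∘ₗ tableBracket c (Pi.single a 1)))
      (table_ext fun e => ?_) z
    funext l
    have hJ := congrArg (Int.cast : ℤ → ℂ) (H.jacobi a d e l)
    rw [ha, hd] at hJ
    push_cast at hJ
    simp [tableBracket_single, map_sum, LinearMap.sum_apply, Finset.sum_apply,
      Pi.single_apply, hJ, Finset.mul_sum]
    exact Finset.sum_congr rfl fun k _ => by ring
  form := tableForm r b
  form_nondegenerate := by
    have hs : ∀ i k, ∑ m, b m i * b m k = if i = k then 1 else 0 := H.orthogonal
    have hs' : ∀ i k, ∑ m, ((b m i : ℤ) : ℂ) * (b m k : ℂ) = if i = k then 1 else 0 := by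
      intro i k
      exact_mod_cast congrArg (Int.cast : ℤ → ℂ) (hs i k)
    have hM : (Matrix.of fun i j => ((b i j : ℤ) : ℂ)).transpose *
        (Matrix.of fun i j => ((b i j : ℤ) : ℂ)) = 1 := by
      ext i k
      simp [Matrix.mul_apply, Matrix.one_apply, hs']
    have hM' := mul_eq_one_comm.mp hM
    have hs2 : ∀ i k, ∑ m, ((b i m : ℤ) : ℂ) * (b k m : ℂ) = if i = k then 1 else 0 := by
      intro i k
      have := congrFun (congrFun hM' i) k
      simpa [Matrix.mul_apply, Matrix.one_apply] using this
    refine ⟨fun x hx => ?_, fun y hy => ?_⟩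
    · funext k
      have h := hx (fun j => (b k j : ℂ))
      have e : tableForm (r : ℂ) b x (fun j => (b k j : ℂ)) = r * x k := by
        have : ∀ i, ∑ j, x i * (b k j : ℂ) * (r * (b i j : ℂ)) =
            r * x i * ∑ j, (b i j : ℂ) * (b k j : ℂ) := by
          intro i
          rw [Finset.mul_sum]
          exact Finset.sum_congr rfl fun j _ => by ring
        simp [tableForm, LinearMap.mk₂_apply, this, hs2]
      rw [e] at h
      simpa using h
    · funext k
      have h := hy (fun j => (b j k : ℂ))
      have e : tableForm (r : ℂ) b (fun j => (b j k : ℂ)) y = r * y k := by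
        have : ∀ j, ∑ i, (b i k : ℂ) * y j * (r * (b i j : ℂ)) =
            r * y j * ∑ i, (b i k : ℂ) * (b i j : ℂ) := by
          intro j
          rw [Finset.mul_sum]
          exact Finset.sum_congr rfl fun i _ => by ring
        simp only [tableForm, LinearMap.mk₂_apply]
        rw [Finset.sum_comm]
        simp [this, hs']
      rw [e] at h
      simpa using h
  form_even := by
    intro x y hx hy
    refine table_ext_span (f := (tableForm (r : ℂ) b).flip y) (h := 0) (fun a ha => ?_) x hx
    refine table_ext_span (f := tableForm (r : ℂ) b (Pi.single a 1)) (h := 0)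
      (fun d hd => ?_) y hy
    have : b a d = 0 := by
      by_contra h
      have := H.form_even a d h
      rw [ha, hd] at this
      exact absurd this (by decide)
    simp [tableForm_single, this]
  form_supersymm := by
    intro i j x y hx hy
    refine table_ext_span (f := (tableForm (r : ℂ) b).flip y)
      (h := superSign i j • tableForm (r : ℂ) b y) (fun a ha => ?_) x hx
    refine table_ext_span (f := tableForm (r : ℂ) b (Pi.single a 1))
      (h := superSign i j • (tableForm (r : ℂ) b).flip (Pi.single a 1)) (fun d hd => ?_) y hy
    change tableForm (r : ℂ) b (Pi.single a 1) (Pi.single d 1) =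
      superSign i j • tableForm (r : ℂ) b (Pi.single d 1) (Pi.single a 1)
    rw [tableForm_single, tableForm_single, H.form_symm a d, ha, hd, zsmul_eq_mul]
    push_cast
    ring
  form_invariant := by
    intro x y z
    refine LinearMap.congr_fun (f := (tableForm (r : ℂ) b).flip z ∘ₗ (tableBracket c).flip y)
      (g := (tableForm (r : ℂ) b).flip (tableBracket c y z)) (table_ext fun a => ?_) x
    refine LinearMap.congr_fun
      (f := (tableForm (r : ℂ) b).flip z ∘ₗ tableBracket c (Pi.single a 1))
      (g := tableForm (r : ℂ) b (Pi.single a 1) ∘ₗ (tableBracket c).flip z)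
      (table_ext fun d => ?_) y
    refine LinearMap.congr_fun
      (f := tableForm (r : ℂ) b (tableBracket c (Pi.single a 1) (Pi.single d 1)))
      (g := tableForm (r : ℂ) b (Pi.single a 1) ∘ₗ tableBracket c (Pi.single d 1))
      (table_ext fun e => ?_) z
    have hI := congrArg (fun t : ℤ => (r : ℂ) * (t : ℂ)) (H.invariant a d e)
    push_cast at hI
    simp only [LinearMap.comp_apply, tableBracket_single, map_sum, map_smul,
      LinearMap.sum_apply, LinearMap.smul_apply, tableForm_single, smul_eq_mul]
    simp only [Finset.mul_sum] at hI
    rw [Finset.sum_congr rfl fun k _ => mul_left_comm _ _ _, hI]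
    exact Finset.sum_congr rfl fun k _ => mul_left_comm _ _ _

end Table

/-- `o(3)`, even, with basis `e₀, e₁, e₂`: `[e₀, e₁] = e₂`, `[e₁, e₂] = e₀`, `[e₂, e₀] = e₁`
and `B(e_a, e_a) = r` for a nonzero scalar `r` (so `B` is `-r/2` times the Killing form). -/
def g3 (r : ℂˣ) : QuadraticLieSuperalgebra (Fin 3 → ℂ) :=
  ofTable ![0, 0, 0]
    (tableBracketCoeff ![0, 0, 0] [(0, 1, 2, 1), (1, 2, 0, 1), (2, 0, 1, 1)]) r
    (tableFormCoeff ![0, 0, 0] [(0, 0), (1, 1), (2, 2)])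
    (by constructor <;> decide +kernel)

/-- The even algebra with basis `X, P, Q, Z`: `[X, P] = P`, `[X, Q] = -Q`, `[P, Q] = Z` and
`B(X, Z) = B(P, Q) = 1`. -/
def g4 : QuadraticLieSuperalgebra (Fin 4 → ℂ) :=
  ofTable ![0, 0, 0, 0]
    (tableBracketCoeff ![0, 0, 0, 0] [(0, 1, 1, 1), (0, 2, 2, -1), (1, 2, 3, 1)]) 1
    (tableFormCoeff ![0, 0, 0, 0] [(0, 3), (1, 2)])
    (by constructor <;> decide +kernel)

/-- The even algebra with basis `X₁, X₂, T, Z₁, Z₂`: `[X₁, X₂] = T`, `[X₁, T] = -Z₂`,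
`[X₂, T] = Z₁` and `B(X₁, Z₁) = B(X₂, Z₂) = B(T, T) = 1`. -/
def g5 : QuadraticLieSuperalgebra (Fin 5 → ℂ) :=
  ofTable ![0, 0, 0, 0, 0]
    (tableBracketCoeff ![0, 0, 0, 0, 0] [(0, 1, 2, 1), (0, 2, 4, -1), (1, 2, 3, 1)]) 1
    (tableFormCoeff ![0, 0, 0, 0, 0] [(0, 3), (1, 4), (2, 2)])
    (by constructor <;> decide +kernel)

/-- The even algebra with basis `X₁, X₂, X₃, Z₁, Z₂, Z₃`: `[X₁, X₂] = Z₃`, `[X₂, X₃] = Z₁`,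
`[X₃, X₁] = Z₂` and `B(X₁, Z₁) = B(X₂, Z₂) = B(X₃, Z₃) = 1`. -/
def g6 : QuadraticLieSuperalgebra (Fin 6 → ℂ) :=
  ofTable ![0, 0, 0, 0, 0, 0]
    (tableBracketCoeff ![0, 0, 0, 0, 0, 0] [(0, 1, 5, 1), (1, 2, 3, 1), (2, 0, 4, 1)]) 1
    (tableFormCoeff ![0, 0, 0, 0, 0, 0] [(0, 3), (1, 4), (2, 5)])
    (by constructor <;> decide +kernel)

/-- Even basis vectors `X₀, Y₀`, odd basis vectors `X₁, Z₁`; `[Z₁, Z₁] = -2 X₀`,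
`[Y₀, Z₁] = -2 X₁` and `B(X₀, Y₀) = B(X₁, Z₁) = 1`. -/
def gs41 : QuadraticLieSuperalgebra (Fin 4 → ℂ) :=
  ofTable ![0, 0, 1, 1]
    (tableBracketCoeff ![0, 0, 1, 1] [(3, 3, 0, -2), (1, 3, 2, -2)]) 1
    (tableFormCoeff ![0, 0, 1, 1] [(0, 1), (2, 3)])
    (by constructor <;> decide +kernel)

/-- Even basis vectors `X₀, Y₀`, odd basis vectors `X₁, Y₁`; `[X₁, Y₁] = X₀`,
`[Y₀, X₁] = X₁`, `[Y₀, Y₁] = -Y₁` and `B(X₀, Y₀) = B(X₁, Y₁) = 1`. -/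
def gs42 : QuadraticLieSuperalgebra (Fin 4 → ℂ) :=
  ofTable ![0, 0, 1, 1]
    (tableBracketCoeff ![0, 0, 1, 1] [(2, 3, 0, 1), (1, 2, 2, 1), (1, 3, 3, -1)]) 1
    (tableFormCoeff ![0, 0, 1, 1] [(0, 1), (2, 3)])
    (by constructor <;> decide +kernel)

/-- Even basis vectors `X₀, Y₀`, odd basis vectors `X₁, Y₁, Z₁, T₁`; `[Z₁, T₁] = -X₀`,
`[Y₀, Z₁] = -Y₁`, `[Y₀, T₁] = -X₁` and `B(X₀, Y₀) = B(X₁, Z₁) = B(Y₁, T₁) = 1`. -/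
def gs6 : QuadraticLieSuperalgebra (Fin 6 → ℂ) :=
  ofTable ![0, 0, 1, 1, 1, 1]
    (tableBracketCoeff ![0, 0, 1, 1, 1, 1] [(4, 5, 0, -1), (1, 4, 3, -1), (1, 5, 2, -1)]) 1
    (tableFormCoeff ![0, 0, 1, 1, 1, 1] [(0, 1), (2, 4), (3, 5)])
    (by constructor <;> decide +kernel)

/-- The members of the list of quadratic Lie algebras of type `S₃`. -/
inductive LieModel
  | g3 (r : ℂˣ)
  | g4
  | g5
  | g6

/-- The members of the list of quadratic Lie superalgebras with nonzero odd part. -/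
inductive SuperModel
  | gs41
  | gs42
  | gs6

def LieModel.dim : LieModel → ℕ
  | .g3 _ => 3
  | .g4 => 4
  | .g5 => 5
  | .g6 => 6

def LieModel.algebra : (m : LieModel) → QuadraticLieSuperalgebra (Fin m.dim → ℂ)
  | .g3 r => QuadraticLieSuperalgebra.g3 r
  | .g4 => QuadraticLieSuperalgebra.g4
  | .g5 => QuadraticLieSuperalgebra.g5
  | .g6 => QuadraticLieSuperalgebra.g6

def SuperModel.dim : SuperModel → ℕ
  | .gs41 => 4
  | .gs42 => 4
  | .gs6 => 6

def SuperModel.algebra : (m : SuperModel) → QuadraticLieSuperalgebra (Fin m.dim → ℂ)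
  | .gs41 => QuadraticLieSuperalgebra.gs41
  | .gs42 => QuadraticLieSuperalgebra.gs42
  | .gs6 => QuadraticLieSuperalgebra.gs6

/-- `g` is i-isomorphic to the given member of the full list. -/
def IsModelledBy {V : Type*} [AddCommGroup V] [Module ℂ V] (g : QuadraticLieSuperalgebra V) :
    LieModel ⊕ SuperModel → Prop
  | .inl m => g.IIsomorphic m.algebra
  | .inr m => g.IIsomorphic m.algebra

end QuadraticLieSuperalgebra

/-!
The form identifies the factors of a decomposable invariant with vectors `u`, `v`, `w`. Since the
invariant is even, `u` may be taken even and `v`, `w` of the same parity; the bracket is then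
determined by the form and these three vectors. In a reduced algebra, every isometric graded map
from a model that hits `u`, `v`, `w` is onto: the orthogonal complement of its image is central,
hence totally isotropic, and it is non-degenerate. So only the geometry of `u`, `v`, `w` matters.

If `v`, `w` are even, the form is diagonalised on the span of `u`, `v`, `w`, and the number of
isotropic vectors in an orthogonal basis distinguishes `𝔤₃(λ)`, `𝔤₄`, `𝔤₅` and `𝔤₆`. If they are
odd, the super-Jacobi identity forces `u` to be isotropic, and the model is `𝔤ˢ_{4,1}`,
`𝔤ˢ_{4,2}` or `𝔤ˢ_6` according to whether `v`, `w` are proportional, span a non-degenerate plane,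
or span a totally isotropic plane. Dimensions separate the models, except that `λ` is read off
iterated brackets, and that `𝔤ˢ_{4,1}` and `𝔤ˢ_{4,2}` differ in nilpotency.
-/

section SignedWedge

variable {X R : Type*} [CommRing R]

/-- The product of three scalar functions, antisymmetric for `σ = 1`, where it is the exterior
product of three linear forms. For `σ = -1` it is the super-exterior product of an even linear form
`α` with two odd linear forms `β` and `γ`. -/
def signedWedge (σ : R) (α β γ : X → R) (x y z : X) : R :=
  α x * (σ * (β y * γ z) - β z * γ y) - α y * (σ * (β x * γ z) - β z * γ x) +
    α z * (σ * (β x * γ y) - β y * γ x)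

theorem signedWedge_smul (σ a b c : R) (α β γ : X → R) (x y z : X) :
    signedWedge σ (a • α) (b • β) (c • γ) x y z = a * b * c * signedWedge σ α β γ x y z := by
  simp only [signedWedge, Pi.smul_apply, smul_eq_mul]
  ring

theorem signedWedge_one_rotate (α β γ : X → R) (x y z : X) :
    signedWedge 1 β γ α x y z = signedWedge 1 α β γ x y z := by
  simp only [signedWedge]
  ring

theorem exists_trilinear_eq_signedWedge {V : Type*} [AddCommGroup V] [Module R V] (σ : R)
    (α β γ : Module.Dual R V) : ∃ t : V →ₗ[R] V →ₗ[R] V →ₗ[R] R,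
      ∀ x y z, t x y z = signedWedge σ α β γ x y z := by
  let t (α β γ : V →ₗ[R] R) : V →ₗ[R] V →ₗ[R] V →ₗ[R] R := α.smulRight (β.smulRight γ)
  refine ⟨σ • t α β γ + t (-α) γ β + σ • t (-β) α γ + t γ α β + σ • t β γ α + t (-γ) β α,
    fun x y z => ?_⟩
  simp only [t, signedWedge, LinearMap.add_apply, LinearMap.neg_apply, LinearMap.smul_apply,
    LinearMap.smulRight_apply, smul_eq_mul]
  ring

theorem signedWedge_one_eq_det (α β γ : X → R) (x y z : X) :
    signedWedge 1 α β γ x y z = (Matrix.of fun k j => ![α, β, γ] k (![x, y, z] j)).det := by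
  simp only [signedWedge, Matrix.det_fin_three, Matrix.of_apply, Matrix.cons_val]
  ring

theorem signedWedge_one_sum_smul (P : Matrix (Fin 3) (Fin 3) R) (α : Fin 3 → X → R) (x y z : X) :
    signedWedge 1 (∑ j, P 0 j • α j) (∑ j, P 1 j • α j) (∑ j, P 2 j • α j) x y z =
      P.det * signedWedge 1 (α 0) (α 1) (α 2) x y z := by
  simp only [signedWedge, Matrix.det_fin_three, Fin.sum_univ_three, Pi.add_apply, Pi.smul_apply,
    smul_eq_mul]
  ring

theorem linearIndependent_of_signedWedge_ne_zero {K V : Type*} [Field K] [AddCommGroup V]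
    [Module K V] {α β γ : Module.Dual K V} {x y z : V} (h : signedWedge 1 α β γ x y z ≠ 0) :
    LinearIndependent K ![α, β, γ] := by
  have hdet : (Matrix.of fun k j => ![α, β, γ] k (![x, y, z] j)).det ≠ 0 := by
    rw [signedWedge_one_eq_det] at h
    convert! h using 5 with k
    fin_cases k <;> rfl
  exact LinearIndependent.of_comp (LinearMap.pi fun j => LinearMap.applyₗ (![x, y, z] j))
    (Matrix.linearIndependent_rows_of_det_ne_zero hdet)

end SignedWedge

section BilinForm

open LinearMap (BilinForm)

variable {K V ι : Type*} [Field K] [AddCommGroup V] [Module K V] {B : BilinForm K V}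

theorem exists_dual_family [FiniteDimensional K V] [DecidableEq ι]
    (hB : B.Nondegenerate) {v : ι → V} (hv : LinearIndependent K v) :
    ∃ x : ι → V, ∀ i j, B (v i) (x j) = if i = j then 1 else 0 := by
  obtain ⟨f, hf⟩ := (Finsupp.linearCombination K v).exists_leftInverse_of_injective
    (LinearMap.ker_eq_bot.2 hv)
  refine ⟨fun j => (B.flip.toDual hB.flip).symm (Finsupp.lapply j ∘ₗ f), fun i j => ?_⟩
  have hfv : f (v i) = Finsupp.single i 1 := by
    simpa using LinearMap.congr_fun hf (Finsupp.single i 1)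
  calc B (v i) _ = (Finsupp.lapply j ∘ₗ f) (v i) :=
        BilinForm.apply_toDual_symm_apply (hB := hB.flip) _ (v i)
    _ = if i = j then 1 else 0 := by
        rw [LinearMap.comp_apply, hfv, Finsupp.lapply_apply, Finsupp.single_apply]

variable [Fintype ι]

/-- The modification of a family `x`, dual to a family `z` of pairwise orthogonal isotropic vectors,
by elements of the span of `z`, chosen so as to make `x` isotropic and pairwise orthogonal too. -/
def isotropicCorrection (B : BilinForm K V) (z x : ι → V) (i : ι) : V :=
  x i - (2 : K)⁻¹ • ∑ j, B (x i) (x j) • z j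

theorem isotropicCorrection_mem {p : Submodule K V} {z x : ι → V} (hz : ∀ i, z i ∈ p)
    (hx : ∀ i, x i ∈ p) (i : ι) : isotropicCorrection B z x i ∈ p :=
  p.sub_mem (hx i) <| p.smul_mem _ <| p.sum_mem fun j _ => p.smul_mem _ (hz j)

theorem apply_isotropicCorrection {u : V} {z : ι → V} (hu : ∀ j, B u (z j) = 0) (x : ι → V)
    (i : ι) : B u (isotropicCorrection B z x i) = B u (x i) := by
  simp [isotropicCorrection, hu]

theorem isotropicCorrection_apply_self [DecidableEq ι] (h2 : (2 : K) ≠ 0) {s : K}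
    {z x : ι → V} (hzz : ∀ i j, B (z i) (z j) = 0)
    (hzx : ∀ i j, B (z i) (x j) = if i = j then 1 else 0)
    (hxz : ∀ i j, B (x i) (z j) = s * B (z j) (x i))
    (hxx : ∀ i j, B (x i) (x j) = s * B (x j) (x i)) (i j : ι) :
    B (isotropicCorrection B z x i) (isotropicCorrection B z x j) = 0 := by
  have hleft : B (isotropicCorrection B z x i) (x j) = (2 : K)⁻¹ * B (x i) (x j) := by
    simp only [isotropicCorrection, map_sub, map_smul, map_sum, LinearMap.sub_apply,
      LinearMap.smul_apply, LinearMap.sum_apply, hzx, smul_eq_mul, mul_ite, mul_one, mul_zero,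
      Finset.sum_ite_eq', Finset.mem_univ, if_true]
    field_simp
    ring
  have hright : ∀ k, B (isotropicCorrection B z x i) (z k) = s * if k = i then 1 else 0 := by
    intro k
    simp [isotropicCorrection, hzz, hxz, hzx]
  conv_lhs => enter [2]; unfold isotropicCorrection
  simp only [map_sub, map_smul, map_sum, hright, hleft, smul_eq_mul, mul_ite, mul_one, mul_zero,
    Finset.sum_ite_eq', Finset.mem_univ, if_true]
  rw [hxx i j]
  ring

end BilinForm

@[simp]
theorem superSign_zero_left (i : ZMod 2) : superSign 0 i = 1 := by
  simp only [superSign, ZMod.val_zero, zero_mul, pow_zero]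

@[simp]
theorem superSign_one_one : superSign 1 1 = -1 := by decide

namespace ZModTwo

theorem eq_zero_or_eq_one : ∀ i : ZMod 2, i = 0 ∨ i = 1 := by decide

theorem ne_add_one : ∀ i : ZMod 2, i ≠ i + 1 := by decide

theorem eq_add_one_of_ne : ∀ {i j : ZMod 2}, i ≠ j → j = i + 1 := by decide

end ZModTwo

namespace LieSuperalgebra

variable {V : Type*} [AddCommGroup V] [Module ℂ V] (g : LieSuperalgebra V)

theorem evenProj_mem (x : V) : g.evenProj x ∈ g.part 0 :=
  Submodule.projection_apply_mem _ x

theorem oddProj_mem (x : V) : g.oddProj x ∈ g.part 1 :=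
  Submodule.projection_apply_mem _ x

theorem evenProj_add_oddProj (x : V) : g.evenProj x + g.oddProj x = x :=
  Submodule.projection_add_projection_eq_self _ x

@[simp]
theorem evenProj_evenProj (x : V) : g.evenProj (g.evenProj x) = g.evenProj x :=
  (Submodule.projection_eq_self_iff _ _).2 (g.evenProj_mem x)

variable {g} in
theorem evenProj_of_mem_odd {x : V} (hx : x ∈ g.part 1) : g.evenProj x = 0 :=
  (Submodule.projection_apply_eq_zero_iff _).2 hx

variable {g} in
theorem oddProj_of_mem_even {x : V} (hx : x ∈ g.part 0) : g.oddProj x = 0 :=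
  (Submodule.projection_apply_eq_zero_iff _).2 hx

@[simp]
theorem evenProj_oddProj (x : V) : g.evenProj (g.oddProj x) = 0 :=
  evenProj_of_mem_odd (g.oddProj_mem x)

@[simp]
theorem oddProj_oddProj (x : V) : g.oddProj (g.oddProj x) = g.oddProj x :=
  (Submodule.projection_eq_self_iff _ _).2 (g.oddProj_mem x)

@[simp]
theorem oddProj_evenProj (x : V) : g.oddProj (g.evenProj x) = 0 :=
  oddProj_of_mem_even (g.evenProj_mem x)

theorem exists_add_eq (i : ZMod 2) (x : V) :
    ∃ y ∈ g.part i, ∃ z ∈ g.part (i + 1), y + z = x := by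
  rcases ZModTwo.eq_zero_or_eq_one i with rfl | rfl
  · exact ⟨_, g.evenProj_mem x, _, g.oddProj_mem x, g.evenProj_add_oddProj x⟩
  · exact ⟨_, g.oddProj_mem x, _, g.evenProj_mem x, by rw [add_comm, g.evenProj_add_oddProj]⟩

section Wedge

variable (α β γ : Module.Dual ℂ V)

theorem apply_eq_evenProj_add_oddProj (x : V) : α x = α (g.evenProj x) + α (g.oddProj x) := by
  rw [← map_add, g.evenProj_add_oddProj]

theorem apply_parityInv (x : V) : α (g.parityInv x) = α (g.evenProj x) - α (g.oddProj x) := by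
  rw [parityInv, LinearMap.sub_apply, map_sub]

theorem evenProj_parityInv (x : V) : g.evenProj (g.parityInv x) = g.evenProj x := by
  simp [parityInv]

theorem oddProj_parityInv (x : V) : g.oddProj (g.parityInv x) = -g.oddProj x := by
  simp [parityInv]

theorem wedge_one_form :
    g.wedge β (fun Y : Fin 1 → V => γ (Y 0)) = fun Y : Fin 2 → V =>
      β (g.evenProj (Y 0)) * γ (Y 1) + β (g.oddProj (Y 0)) * γ (g.parityInv (Y 1))
        - β (Y 1) * γ (Y 0) := by
  funext Y
  rw [g.apply_eq_evenProj_add_oddProj β (Y 1)]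
  simp [wedge, Fin.sum_univ_two, Fin.succAbove]
  ring

theorem wedge_two_form (A : V → V → ℂ) (x y z : V) :
    g.wedge α (fun Y : Fin 2 → V => A (Y 0) (Y 1)) ![x, y, z] =
      α (g.evenProj x) * A y z + α (g.oddProj x) * A (g.parityInv y) (g.parityInv z)
        - (α (g.evenProj y) * A x z + α (g.oddProj y) * A x (g.parityInv z))
        + α z * A x y := by
  rw [g.apply_eq_evenProj_add_oddProj α z, wedge, Fin.sum_univ_three]
  simp [Fin.succAbove]
  ring

end Wedge

end LieSuperalgebra

namespace QuadraticLieSuperalgebra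

variable {V : Type*} [AddCommGroup V] [Module ℂ V] (g : QuadraticLieSuperalgebra V)

theorem eq_of_form_eq {x x' : V} (h : ∀ y, g.form x y = g.form x' y) : x = x' :=
  sub_eq_zero.1 <| g.form_nondegenerate.1 _ fun y => by
    rw [map_sub, LinearMap.sub_apply, h, sub_self]

theorem exists_form_eq [FiniteDimensional ℂ V] (α : Module.Dual ℂ V) : ∃ a, g.form a = α :=
  ⟨(g.form.toDual g.form_nondegenerate).symm α,
    LinearMap.ext (LinearMap.BilinForm.apply_toDual_symm_apply α)⟩

theorem form_eq_zero_of_ne {i j : ZMod 2} (hij : i ≠ j) {x y : V} (hx : x ∈ g.part i)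
    (hy : y ∈ g.part j) : g.form x y = 0 := by
  obtain rfl := ZModTwo.eq_add_one_of_ne hij
  rcases ZModTwo.eq_zero_or_eq_one i with rfl | rfl
  · exact g.form_even x y hx hy
  · rw [g.form_supersymm _ _ x y hx hy, g.form_even y x hy hx, smul_zero]

theorem form_comm {i : ZMod 2} {x : V} (hx : x ∈ g.part i) (y : V) :
    g.form x y = (superSign i i : ℂ) * g.form y x := by
  obtain ⟨y, hy, y', hy', rfl⟩ := g.exists_add_eq i y
  rw [map_add, map_add, LinearMap.add_apply, g.form_eq_zero_of_ne (ZModTwo.ne_add_one i) hx hy',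
    g.form_eq_zero_of_ne (ZModTwo.ne_add_one i).symm hy' hx, g.form_supersymm i i x y hx hy,
    zsmul_eq_mul, add_zero, add_zero]

theorem form_comm_even {x : V} (hx : x ∈ g.part 0) (y : V) : g.form x y = g.form y x := by
  simpa using g.form_comm hx y

theorem form_comm_odd {x : V} (hx : x ∈ g.part 1) (y : V) : g.form x y = -g.form y x := by
  simpa using g.form_comm hx y

theorem form_self_odd {x : V} (hx : x ∈ g.part 1) : g.form x x = 0 :=
  self_eq_neg.1 (g.form_comm_odd hx x)

theorem mem_part_of_form_eq_zero {i : ZMod 2} {a : V}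
    (h : ∀ x ∈ g.part (i + 1), g.form a x = 0) : a ∈ g.part i := by
  obtain ⟨b, hb, c, hc, rfl⟩ := g.exists_add_eq i a
  suffices c = 0 by rwa [this, add_zero]
  refine g.form_nondegenerate.1 c fun y => ?_
  obtain ⟨y, hy, y', hy', rfl⟩ := g.exists_add_eq i y
  rw [map_add, g.form_eq_zero_of_ne (ZModTwo.ne_add_one i).symm hc hy, zero_add]
  simpa [g.form_eq_zero_of_ne (ZModTwo.ne_add_one i) hb hy'] using h y' hy'

theorem form_bracket_eq_zero {i j k : ZMod 2} (hijk : i + j ≠ k) {x y z : V} (hx : x ∈ g.part i)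
    (hy : y ∈ g.part j) (hz : z ∈ g.part k) : g.form (g.bracket x y) z = 0 :=
  g.form_eq_zero_of_ne hijk (g.bracket_mem i j x y hx hy) hz

theorem form_bracket_parityInv (x y z : V) :
    g.form (g.bracket (g.parityInv x) (g.parityInv y)) (g.parityInv z) =
      g.form (g.bracket x y) z := by
  have he := g.evenProj_mem
  have ho := g.oddProj_mem
  conv_rhs => rw [← g.evenProj_add_oddProj x, ← g.evenProj_add_oddProj y,
    ← g.evenProj_add_oddProj z]
  simp only [LieSuperalgebra.parityInv, map_add, map_sub, LinearMap.add_apply, LinearMap.sub_apply]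
  rw [g.form_bracket_eq_zero (by decide) (he x) (he y) (ho z),
    g.form_bracket_eq_zero (by decide) (he x) (ho y) (he z),
    g.form_bracket_eq_zero (by decide) (ho x) (he y) (he z),
    g.form_bracket_eq_zero (by decide) (ho x) (ho y) (ho z)]
  ring

variable {g}

theorem mem_center_iff {x : V} : x ∈ g.center ↔ ∀ y z, g.form (g.bracket x y) z = 0 :=
  ⟨fun hx y z => by rw [LinearMap.mem_ker.1 hx]; simp,
    fun h => LinearMap.mem_ker.2 <| LinearMap.ext fun y => g.form_nondegenerate.1 _ (h y)⟩

theorem IsReduced.exists_form_bracket_ne_zero (hg : g.IsReduced) :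
    ∃ x y z, g.form (g.bracket x y) z ≠ 0 := by
  obtain ⟨hV, hcenter⟩ := hg
  by_contra! h
  obtain ⟨x, hx⟩ := exists_ne (0 : V)
  exact hx <| g.form_nondegenerate.1 x fun y =>
    hcenter x (mem_center_iff.2 fun _ => h x _) y (mem_center_iff.2 fun _ => h y _)

/-- `g.IsFactorization i u v w` says that the invariant of `g` is the super-exterior product of the
linear forms `B(u, ·)`, `B(v, ·)` and `B(w, ·)`, where `u` is even and `v`, `w` have parity `i`. -/
structure IsFactorization (g : QuadraticLieSuperalgebra V) (i : ZMod 2) (u v w : V) : Prop where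
  mem_even : u ∈ g.part 0
  mem_left : v ∈ g.part i
  mem_right : w ∈ g.part i
  form_bracket : ∀ x y z, g.form (g.bracket x y) z =
    signedWedge (superSign i i : ℂ) (g.form u) (g.form v) (g.form w) x y z

namespace IsFactorization

variable {i : ZMod 2} {u v w : V}

theorem smul (h : g.IsFactorization i u v w) {a b c : ℂ} (habc : a * b * c = 1) :
    g.IsFactorization i (a • u) (b • v) (c • w) where
  mem_even := Submodule.smul_mem _ a h.mem_even
  mem_left := Submodule.smul_mem _ b h.mem_left
  mem_right := Submodule.smul_mem _ c h.mem_right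
  form_bracket x y z := by
    simp only [map_smul, LinearMap.coe_smul, signedWedge_smul, habc, one_mul, h.form_bracket]

theorem rotate (h : g.IsFactorization 0 u v w) : g.IsFactorization 0 v w u where
  mem_even := h.mem_left
  mem_left := h.mem_right
  mem_right := h.mem_even
  form_bracket x y z := by
    rw [h.form_bracket, superSign_zero_left, Int.cast_one, ← signedWedge_one_rotate]

theorem bracket_eq (h : g.IsFactorization i u v w) (x y : V) :
    g.bracket x y =
      ((superSign i i : ℂ) * (g.form v x * g.form w y) - g.form v y * g.form w x) • u +
      (g.form u y * g.form w x - g.form u x * g.form w y) • v +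
      ((superSign i i : ℂ) * (g.form u x * g.form v y - g.form u y * g.form v x)) • w :=
  g.eq_of_form_eq fun z => by
    simp only [h.form_bracket, signedWedge, map_add, map_smul, LinearMap.add_apply,
      LinearMap.smul_apply, smul_eq_mul]
    ring

theorem mem_center (h : g.IsFactorization i u v w) {x : V} (hu : g.form u x = 0)
    (hv : g.form v x = 0) (hw : g.form w x = 0) : x ∈ g.center :=
  LinearMap.mem_ker.2 <| LinearMap.ext fun y => by simp [h.bracket_eq, hu, hv, hw]

theorem ne_zero_even (h : g.IsFactorization i u v w) (hg : g.IsReduced) : u ≠ 0 := by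
  rintro rfl
  obtain ⟨x, y, z, hxyz⟩ := hg.exists_form_bracket_ne_zero
  exact hxyz (by simp [h.form_bracket, signedWedge])

theorem ne_zero_left (h : g.IsFactorization i u v w) (hg : g.IsReduced) : v ≠ 0 := by
  rintro rfl
  obtain ⟨x, y, z, hxyz⟩ := hg.exists_form_bracket_ne_zero
  exact hxyz (by simp [h.form_bracket, signedWedge])

end IsFactorization

end QuadraticLieSuperalgebra

namespace LieSuperalgebra

variable {V : Type*} [AddCommGroup V] [Module ℂ V] (g : LieSuperalgebra V)
  (α β γ : Module.Dual ℂ V)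

theorem wedge_wedge_apply (x y z : V) :
    let a := α ∘ g.evenProj
    let b := β ∘ g.evenProj
    let c := γ ∘ g.evenProj
    let a' := α ∘ g.oddProj
    let b' := β ∘ g.oddProj
    let c' := γ ∘ g.oddProj
    g.wedge α (g.wedge β (fun Y : Fin 1 → V => γ (Y 0))) ![x, y, z] =
      signedWedge 1 a b c x y z + signedWedge (-1) a b' c' x y z
        - signedWedge (-1) b a' c' x y z + signedWedge (-1) c a' b' x y z
        + signedWedge 1 a b c' x y z + signedWedge 1 a b' c x y z + signedWedge 1 a' b c x y z
        - (a' x * (b' y * c' z + b' z * c' y) + a' y * (b' x * c' z + b' z * c' x) +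
          a' z * (b' x * c' y + b' y * c' x)) := by
  rw [wedge_one_form, g.wedge_two_form α fun y z =>
    β (g.evenProj y) * γ z + β (g.oddProj y) * γ (g.parityInv z) - β z * γ y]
  simp only [signedWedge, Function.comp_apply, g.apply_parityInv, evenProj_parityInv,
    oddProj_parityInv, map_neg]
  rw [g.apply_eq_evenProj_add_oddProj α z, g.apply_eq_evenProj_add_oddProj β y,
    g.apply_eq_evenProj_add_oddProj β z, g.apply_eq_evenProj_add_oddProj γ x,
    g.apply_eq_evenProj_add_oddProj γ y, g.apply_eq_evenProj_add_oddProj γ z]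
  ring

variable {α β γ}

theorem wedge_wedge_eq_signedWedge {i : ZMod 2} (hα : ∀ x ∈ g.part 1, α x = 0)
    (hβ : ∀ x ∈ g.part (i + 1), β x = 0) (hγ : ∀ x ∈ g.part (i + 1), γ x = 0) (x y z : V) :
    g.wedge α (g.wedge β (fun Y : Fin 1 → V => γ (Y 0))) ![x, y, z] =
      signedWedge (superSign i i : ℂ) α β γ x y z := by
  have hα' := fun x => hα _ (g.oddProj_mem x)
  simp only [wedge_wedge_apply, signedWedge, Function.comp_apply, hα']
  rw [g.apply_eq_evenProj_add_oddProj α x, g.apply_eq_evenProj_add_oddProj α y,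
    g.apply_eq_evenProj_add_oddProj α z, g.apply_eq_evenProj_add_oddProj β x,
    g.apply_eq_evenProj_add_oddProj β y, g.apply_eq_evenProj_add_oddProj β z,
    g.apply_eq_evenProj_add_oddProj γ x, g.apply_eq_evenProj_add_oddProj γ y,
    g.apply_eq_evenProj_add_oddProj γ z]
  rcases ZModTwo.eq_zero_or_eq_one i with rfl | rfl
  · simp only [hα', fun x => hβ _ (g.oddProj_mem x), fun x => hγ _ (g.oddProj_mem x),
      superSign_zero_left, Int.cast_one]
    ring
  · simp only [hα', fun x => hβ _ (g.evenProj_mem x), fun x => hγ _ (g.evenProj_mem x),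
      superSign_one_one, Int.cast_neg, Int.cast_one]
    ring

end LieSuperalgebra

namespace QuadraticLieSuperalgebra

variable {V : Type*} [AddCommGroup V] [Module ℂ V] {g : QuadraticLieSuperalgebra V}

theorem IsFactorization.isElementary {i : ZMod 2} {u v w : V} (h : g.IsFactorization i u v w) :
    g.IsElementary := by
  refine ⟨g.form u, g.form v, g.form w, funext fun X => ?_⟩
  have hX : X = ![X 0, X 1, X 2] := by
    ext j
    fin_cases j <;> rfl
  rw [hX, g.wedge_wedge_eq_signedWedge (fun x => g.form_even u x h.mem_even)
    (fun x => g.form_eq_zero_of_ne (ZModTwo.ne_add_one i) h.mem_left)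
    (fun x => g.form_eq_zero_of_ne (ZModTwo.ne_add_one i) h.mem_right)]
  exact h.form_bracket _ _ _

theorem exists_isFactorization_of_form_bracket [FiniteDimensional ℂ V] {i : ZMod 2}
    {α β γ : Module.Dual ℂ V} (hα : ∀ x ∈ g.part 1, α x = 0) (hβ : ∀ x ∈ g.part (i + 1), β x = 0)
    (hγ : ∀ x ∈ g.part (i + 1), γ x = 0)
    (h : ∀ x y z, g.form (g.bracket x y) z = signedWedge (superSign i i : ℂ) α β γ x y z) :
    ∃ u v w, g.IsFactorization i u v w := by
  obtain ⟨u, rfl⟩ := g.exists_form_eq α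
  obtain ⟨v, rfl⟩ := g.exists_form_eq β
  obtain ⟨w, rfl⟩ := g.exists_form_eq γ
  exact ⟨u, v, w, g.mem_part_of_form_eq_zero hα, g.mem_part_of_form_eq_zero hβ,
    g.mem_part_of_form_eq_zero hγ, h⟩

section Decomposable

variable {α β γ : Module.Dual ℂ V}
  (h : g.invariant = g.wedge α (g.wedge β (fun Y : Fin 1 → V => γ (Y 0))))

include h

/- The invariant is even, hence equal to the part of its factorization fixed by the parity
involution, while the part which changes sign vanishes. -/
theorem even_and_odd_part_of_invariant_eq_wedge (x y z : V) :
    let a := α ∘ₗ g.evenProj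
    let b := β ∘ₗ g.evenProj
    let c := γ ∘ₗ g.evenProj
    let a' := α ∘ₗ g.oddProj
    let b' := β ∘ₗ g.oddProj
    let c' := γ ∘ₗ g.oddProj
    g.form (g.bracket x y) z =
        signedWedge 1 a b c x y z + signedWedge (-1) a b' c' x y z
          - signedWedge (-1) b a' c' x y z + signedWedge (-1) c a' b' x y z ∧
      signedWedge 1 a b c' x y z + signedWedge 1 a b' c x y z + signedWedge 1 a' b c x y z =
        a' x * (b' y * c' z + b' z * c' y) + a' y * (b' x * c' z + b' z * c' x) +
          a' z * (b' x * c' y + b' y * c' x) := by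
  have h₁ : g.form (g.bracket x y) z = _ := congrFun h ![x, y, z]
  have h₂ : g.form (g.bracket (g.parityInv x) (g.parityInv y)) (g.parityInv z) = _ :=
    congrFun h ![g.parityInv x, g.parityInv y, g.parityInv z]
  rw [form_bracket_parityInv] at h₂
  simp only [LieSuperalgebra.wedge_wedge_apply, signedWedge, Function.comp_apply,
    LieSuperalgebra.evenProj_parityInv, LieSuperalgebra.oddProj_parityInv, map_neg] at h₁ h₂
  simp only [signedWedge, LinearMap.comp_apply]
  constructor
  · linear_combination (h₁ + h₂) / 2
  · linear_combination (h₂ - h₁) / 2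

theorem odd_part_eq_zero_of_invariant_eq_wedge :
    α ∘ₗ g.oddProj = 0 ∨ β ∘ₗ g.oddProj = 0 ∨ γ ∘ₗ g.oddProj = 0 := by
  by_contra! hne
  obtain ⟨x, hx⟩ := Module.Dual.exists_forall_ne_zero_of_forall_exists
    ![α ∘ₗ g.oddProj, β ∘ₗ g.oddProj, γ ∘ₗ g.oddProj] <| by
      simpa [Fin.forall_fin_succ] using
        ⟨DFunLike.ne_iff.1 hne.1, DFunLike.ne_iff.1 hne.2.1, DFunLike.ne_iff.1 hne.2.2⟩
  have hxxx := (even_and_odd_part_of_invariant_eq_wedge h (g.oddProj x) (g.oddProj x)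
    (g.oddProj x)).2
  simp only [signedWedge, LinearMap.comp_apply, LieSuperalgebra.evenProj_oddProj,
    LieSuperalgebra.oddProj_oddProj, map_zero] at hxxx
  refine mul_ne_zero (mul_ne_zero (hx 0) (hx 1)) (hx 2) ?_
  simp only [Matrix.cons_val, LinearMap.comp_apply]
  linear_combination -hxxx / 6

theorem signedWedge_evenProj_eq_zero_of_invariant_eq_wedge
    (hne : ¬(α ∘ₗ g.oddProj = 0 ∧ β ∘ₗ g.oddProj = 0 ∧ γ ∘ₗ g.oddProj = 0)) (x y z : V) :
    signedWedge 1 (α ∘ₗ g.evenProj) (β ∘ₗ g.evenProj) (γ ∘ₗ g.evenProj) x y z = 0 := by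
  have heeo (x y t : V) := (even_and_odd_part_of_invariant_eq_wedge h (g.evenProj x) (g.evenProj y)
    (g.oddProj t)).2
  simp only [signedWedge, LinearMap.comp_apply, LieSuperalgebra.evenProj_evenProj,
    LieSuperalgebra.evenProj_oddProj, LieSuperalgebra.oddProj_evenProj,
    LieSuperalgebra.oddProj_oddProj, map_zero] at heeo ⊢
  by_contra hdet
  refine hne ⟨?_, ?_, ?_⟩ <;> ext t <;> refine (mul_eq_zero.1 ?_).resolve_right hdet <;>
    rw [LinearMap.comp_apply]
  · linear_combination α (g.evenProj x) * heeo y z t - α (g.evenProj y) * heeo x z t +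
      α (g.evenProj z) * heeo x y t
  · linear_combination β (g.evenProj x) * heeo y z t - β (g.evenProj y) * heeo x z t +
      β (g.evenProj z) * heeo x y t
  · linear_combination γ (g.evenProj x) * heeo y z t - γ (g.evenProj y) * heeo x z t +
      γ (g.evenProj z) * heeo x y t

end Decomposable

theorem IsElementary.exists_isFactorization [FiniteDimensional ℂ V] (hg : g.IsElementary) :
    ∃ i u v w, g.IsFactorization i u v w := by
  obtain ⟨α, β, γ, h⟩ := hg
  have heven (δ : Module.Dual ℂ V) : ∀ x ∈ g.part 1, (δ ∘ₗ g.evenProj) x = 0 := fun x hx => by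
    rw [LinearMap.comp_apply, LieSuperalgebra.evenProj_of_mem_odd hx, map_zero]
  have hodd (δ : Module.Dual ℂ V) : ∀ x ∈ g.part (1 + 1), (δ ∘ₗ g.oddProj) x = 0 := fun x hx => by
    rw [LinearMap.comp_apply, LieSuperalgebra.oddProj_of_mem_even hx, map_zero]
  have hform x y z := (even_and_odd_part_of_invariant_eq_wedge h x y z).1
  by_cases hzero : α ∘ₗ g.oddProj = 0 ∧ β ∘ₗ g.oddProj = 0 ∧ γ ∘ₗ g.oddProj = 0
  · obtain ⟨hα, hβ, hγ⟩ := hzero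
    refine ⟨0, exists_isFactorization_of_form_bracket (heven α) (heven β) (heven γ)
      fun x y z => ?_⟩
    simp [hform, signedWedge, hα, hβ, hγ]
  · have hdet := signedWedge_evenProj_eq_zero_of_invariant_eq_wedge h hzero
    refine ⟨1, ?_⟩
    rcases odd_part_eq_zero_of_invariant_eq_wedge h with hα | hβ | hγ
    · refine exists_isFactorization_of_form_bracket (heven α) (hodd β) (hodd γ) fun x y z => ?_
      rw [hform, hdet]
      simp [signedWedge, hα]
    · refine exists_isFactorization_of_form_bracket (heven (-β)) (hodd α) (hodd γ) fun x y z => ?_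
      rw [hform, hdet]
      simp only [signedWedge, hβ, superSign_one_one, Int.cast_neg, Int.cast_one,
        LinearMap.comp_apply, LinearMap.neg_apply, LinearMap.zero_apply]
      ring
    · refine exists_isFactorization_of_form_bracket (heven γ) (hodd α) (hodd β) fun x y z => ?_
      rw [hform, hdet]
      simp [signedWedge, hγ]

end QuadraticLieSuperalgebra

namespace LieSuperalgebra

variable {V : Type*} [AddCommGroup V] [Module ℂ V] (g : LieSuperalgebra V)

theorem disjoint_part (i : ZMod 2) : Disjoint (g.part i) (g.part (i + 1)) := by
  rcases ZModTwo.eq_zero_or_eq_one i with rfl | rfl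
  · exact g.isCompl_part.disjoint
  · exact g.isCompl_part.disjoint.symm

end LieSuperalgebra

namespace QuadraticLieSuperalgebra

variable {V W U : Type*} [AddCommGroup V] [Module ℂ V] [AddCommGroup W] [Module ℂ W]
  [AddCommGroup U] [Module ℂ U] {g : QuadraticLieSuperalgebra V} {h : QuadraticLieSuperalgebra W}
  {k : QuadraticLieSuperalgebra U}

namespace IIsomorphic

theorem symm (H : g.IIsomorphic h) : h.IIsomorphic g := by
  obtain ⟨A, hpart, hbracket, hform⟩ := H
  refine ⟨A.symm, fun i => ?_, fun x y => ?_, fun x y => ?_⟩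
  · rw [← hpart i, ← Submodule.map_comp]
    simp
  · rw [LinearEquiv.symm_apply_eq, hbracket, A.apply_symm_apply, A.apply_symm_apply]
  · rw [← hform, A.apply_symm_apply, A.apply_symm_apply]

theorem trans (H : g.IIsomorphic h) (H' : h.IIsomorphic k) : g.IIsomorphic k := by
  obtain ⟨A, hpart, hbracket, hform⟩ := H
  obtain ⟨A', hpart', hbracket', hform'⟩ := H'
  refine ⟨A.trans A', fun i => ?_, fun x y => ?_, fun x y => ?_⟩
  · rw [← hpart' i, ← hpart i, ← Submodule.map_comp]
    rfl
  · simp only [LinearEquiv.trans_apply, hbracket, hbracket']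
  · simp only [LinearEquiv.trans_apply, hform, hform']

theorem finrank_eq (H : g.IIsomorphic h) : Module.finrank ℂ V = Module.finrank ℂ W :=
  H.choose.finrank_eq

theorem part_eq_bot (H : g.IIsomorphic h) {i : ZMod 2} (hi : g.part i = ⊥) : h.part i = ⊥ := by
  obtain ⟨A, hpart, -, -⟩ := H
  rw [← hpart i, hi, Submodule.map_bot]

end IIsomorphic

section Recognition

variable {φ : W →ₗ[ℂ] V}

theorem injective_of_form_eq (hform : ∀ x y, g.form (φ x) (φ y) = h.form x y) :
    Function.Injective φ := by
  refine (injective_iff_map_eq_zero φ).2 fun x hx => h.form_nondegenerate.1 x fun y => ?_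
  rw [← hform, hx, map_zero, LinearMap.zero_apply]

theorem IsFactorization.map_bracket {i : ZMod 2} {u v w : W} (hh : h.IsFactorization i u v w)
    (hg : g.IsFactorization i (φ u) (φ v) (φ w))
    (hform : ∀ x y, g.form (φ x) (φ y) = h.form x y) (x y : W) :
    φ (h.bracket x y) = g.bracket (φ x) (φ y) := by
  simp only [hh.bracket_eq, hg.bracket_eq, hform, map_add, map_smul]

theorem map_part_eq (hpart : ∀ i, ∀ x ∈ h.part i, φ x ∈ g.part i) (hφ : Function.Surjective φ)
    (i : ZMod 2) : (h.part i).map φ = g.part i := by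
  refine le_antisymm (Submodule.map_le_iff_le_comap.2 (hpart i)) fun x hx => ?_
  obtain ⟨y, rfl⟩ := hφ x
  obtain ⟨y, hy, y', hy', rfl⟩ := h.exists_add_eq i y
  have hφy' : φ y' = 0 := by
    refine Submodule.disjoint_def.1 (g.disjoint_part i) _ ?_ (hpart _ _ hy')
    simpa using sub_mem hx (hpart _ _ hy)
  rw [map_add, hφy', add_zero]
  exact Submodule.mem_map_of_mem hy

theorem form_map_eq_zero_symm (hpart : ∀ i, ∀ x ∈ h.part i, φ x ∈ g.part i) {d : V}
    (hd : ∀ x, g.form d (φ x) = 0) (x : W) : g.form (φ x) d = 0 := by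
  obtain ⟨y, hy, z, hz, rfl⟩ := h.exists_add_eq 0 x
  rw [map_add, map_add, LinearMap.add_apply, g.form_comm (hpart _ _ hy), hd,
    g.form_comm (hpart _ _ hz), hd, mul_zero, mul_zero, add_zero]

theorem IsReduced.surjective_of_form_eq [FiniteDimensional ℂ W] (hg : g.IsReduced)
    (hpart : ∀ i, ∀ x ∈ h.part i, φ x ∈ g.part i)
    (hform : ∀ x y, g.form (φ x) (φ y) = h.form x y)
    (hcenter : ∀ d, (∀ x, g.form (φ x) d = 0) → d ∈ g.center) : Function.Surjective φ := by
  have exists_decomposition : ∀ x, ∃ y d, φ y + d = x ∧ d ∈ g.center ∧ ∀ t, g.form d (φ t) = 0 := by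
    intro x
    obtain ⟨y, hy⟩ := h.exists_form_eq (g.form x ∘ₗ φ)
    have hd : ∀ t, g.form (x - φ y) (φ t) = 0 := fun t => by
      rw [map_sub, LinearMap.sub_apply, hform, hy, LinearMap.comp_apply, sub_self]
    exact ⟨y, x - φ y, add_sub_cancel _ _, hcenter _ (form_map_eq_zero_symm hpart hd), hd⟩
  intro x
  obtain ⟨y, d, rfl, hd, hdφ⟩ := exists_decomposition x
  have hd0 : d = 0 := by
    refine g.form_nondegenerate.1 d fun x' => ?_
    obtain ⟨y', d', rfl, hd', -⟩ := exists_decomposition x'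
    rw [map_add, hdφ, hg.2 d hd d' hd', add_zero]
  exact ⟨y, by rw [hd0, add_zero]⟩

theorem IsReduced.iIsomorphic_of_isFactorization [FiniteDimensional ℂ W] (hg : g.IsReduced)
    {i : ZMod 2} {u v w : W} (hh : h.IsFactorization i u v w)
    (hfac : g.IsFactorization i (φ u) (φ v) (φ w))
    (hpart : ∀ i, ∀ x ∈ h.part i, φ x ∈ g.part i)
    (hform : ∀ x y, g.form (φ x) (φ y) = h.form x y) : g.IIsomorphic h := by
  have hφ : Function.Surjective φ := hg.surjective_of_form_eq hpart hform fun d hd =>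
    hfac.mem_center (hd u) (hd v) (hd w)
  exact IIsomorphic.symm ⟨LinearEquiv.ofBijective φ ⟨injective_of_form_eq hform, hφ⟩,
    map_part_eq hpart hφ, hh.map_bracket hfac hform, hform⟩

end Recognition

end QuadraticLieSuperalgebra

namespace LieSuperalgebra

variable {V : Type*} [AddCommGroup V] [Module ℂ V] {g : LieSuperalgebra V}

theorem wedge_apply_of_part_one_eq_bot (hg : g.part 1 = ⊥) {k : ℕ} (α : Module.Dual ℂ V)
    (A : (Fin k → V) → ℂ) (X : Fin (k + 1) → V) :
    g.wedge α A X =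
      ∑ j : Fin (k + 1), (-1) ^ (j : ℕ) * (α (X j) * A fun i => X (j.succAbove i)) := by
  have hodd : ∀ x, g.oddProj x = 0 := fun x => (Submodule.mem_bot ℂ).1 (hg ▸ g.oddProj_mem x)
  have heven : ∀ x, g.evenProj x = x := fun x => by
    simpa only [hodd, add_zero] using g.evenProj_add_oddProj x
  simp only [wedge, hodd, heven, map_zero, zero_mul, add_zero]

end LieSuperalgebra

namespace QuadraticLieSuperalgebra

variable {V : Type*} [AddCommGroup V] [Module ℂ V] {g : QuadraticLieSuperalgebra V} {u v w : V}

namespace IsFactorization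

variable (h : g.IsFactorization 0 u v w) (hg : g.IsReduced)

include h hg

theorem part_one_eq_bot : g.part 1 = ⊥ := by
  have hcenter : g.part 1 ≤ g.center := fun x hx =>
    h.mem_center (g.form_even u x h.mem_even hx) (g.form_even v x h.mem_left hx)
      (g.form_even w x h.mem_right hx)
  refine (Submodule.eq_bot_iff _).2 fun x hx => g.form_nondegenerate.1 x fun y => ?_
  obtain ⟨y, hy, y', hy', rfl⟩ := g.exists_add_eq 0 y
  rw [map_add, g.form_eq_zero_of_ne (by decide) hx hy, hg.2 x (hcenter hx) y' (hcenter hy'),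
    add_zero]

theorem linearIndependent_form : LinearIndependent ℂ ![g.form u, g.form v, g.form w] := by
  obtain ⟨x, y, z, hxyz⟩ := hg.exists_form_bracket_ne_zero
  rw [h.form_bracket, superSign_zero_left, Int.cast_one] at hxyz
  exact linearIndependent_of_signedWedge_ne_zero hxyz

theorem exists_dual_family [FiniteDimensional ℂ V] :
    ∃ x : Fin 3 → V, ∀ i j, g.form (![u, v, w] i) (x j) = if i = j then 1 else 0 := by
  refine _root_.exists_dual_family g.form_nondegenerate (LinearIndependent.of_comp g.form ?_)
  convert! h.linearIndependent_form hg using 1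
  ext i : 1
  fin_cases i <;> rfl

theorem wedge_invariant_apply (δ : Module.Dual ℂ V) (x y z t : V) :
    g.wedge δ g.invariant ![x, y, z, t] =
      δ x * signedWedge 1 (g.form u) (g.form v) (g.form w) y z t -
        δ y * signedWedge 1 (g.form u) (g.form v) (g.form w) x z t +
        δ z * signedWedge 1 (g.form u) (g.form v) (g.form w) x y t -
        δ t * signedWedge 1 (g.form u) (g.form v) (g.form w) x y z := by
  rw [LieSuperalgebra.wedge_apply_of_part_one_eq_bot (h.part_one_eq_bot hg)]
  simp only [invariant, h.form_bracket, superSign_zero_left, Int.cast_one]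
  simp [Fin.sum_univ_succ, Fin.succAbove]
  ring

theorem dupSpace_eq_span [FiniteDimensional ℂ V] :
    g.dupSpace = Submodule.span ℂ (Set.range ![g.form u, g.form v, g.form w]) := by
  refine le_antisymm (fun δ (hδ : g.wedge δ g.invariant = 0) => ?_) (Submodule.span_le.2 ?_)
  · obtain ⟨x, hx⟩ := h.exists_dual_family hg
    have hu (j) : g.form u (x j) = if 0 = j then 1 else 0 := hx 0 j
    have hv (j) : g.form v (x j) = if 1 = j then 1 else 0 := hx 1 j
    have hw (j) : g.form w (x j) = if 2 = j then 1 else 0 := hx 2 j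
    have hδ_eq : δ = ∑ j, δ (x j) • ![g.form u, g.form v, g.form w] j := by
      ext t
      have ht := congrFun hδ ![t, x 0, x 1, x 2]
      rw [h.wedge_invariant_apply hg] at ht
      simp only [signedWedge, hu, hv, hw, Fin.reduceEq, zero_ne_one, one_ne_zero, ↓reduceIte,
        Pi.zero_apply] at ht
      simp only [Fin.sum_univ_three, Matrix.cons_val, LinearMap.add_apply, LinearMap.smul_apply,
        smul_eq_mul]
      linear_combination ht
    rw [hδ_eq]
    exact Submodule.sum_mem _ fun j _ =>
      Submodule.smul_mem _ _ (Submodule.subset_span (Set.mem_range_self j))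
  · rintro _ ⟨i, rfl⟩
    refine funext fun X => ?_
    have hX : X = ![X 0, X 1, X 2, X 3] := by
      ext j
      fin_cases j <;> rfl
    rw [hX, h.wedge_invariant_apply hg]
    fin_cases i <;>
      simp only [Fin.reduceFinMk, Fin.zero_eta, Fin.mk_one, Matrix.cons_val, signedWedge,
        Pi.zero_apply] <;>
      ring

theorem isSingularS3 [FiniteDimensional ℂ V] : g.IsSingularS3 := by
  refine ⟨fun h0 => ?_, ?_⟩
  · obtain ⟨x, y, z, hxyz⟩ := hg.exists_form_bracket_ne_zero
    exact hxyz (by simp [h0])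
  · rw [dup, h.dupSpace_eq_span hg, finrank_span_eq_card (h.linearIndependent_form hg),
      Fintype.card_fin]

end IsFactorization

theorem IsFactorization.part_one_ne_bot (h : g.IsFactorization 1 u v w) (hg : g.IsReduced) :
    g.part 1 ≠ ⊥ :=
  (Submodule.ne_bot_iff _).2 ⟨v, h.mem_left, h.ne_zero_left hg⟩

end QuadraticLieSuperalgebra

namespace QuadraticLieSuperalgebra

section Table

variable {n : ℕ} {p : Fin n → ZMod 2} {c : Fin n → Fin n → Fin n → ℤ} {r : ℂˣ}
  {b : Fin n → Fin n → ℤ}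

theorem single_mem_tablePart (p : Fin n → ZMod 2) (a : Fin n) :
    (Pi.single a 1 : Fin n → ℂ) ∈ tablePart p (p a) :=
  Submodule.subset_span ⟨a, rfl, rfl⟩

theorem finrank_tablePart (p : Fin n → ZMod 2) (i : ZMod 2) :
    Module.finrank ℂ (tablePart p i) = Fintype.card {a // p a = i} := by
  have h : tablePart p i = Submodule.span ℂ
      (Set.range fun a : {a // p a = i} => (Pi.single a.1 1 : Fin n → ℂ)) := by
    rw [tablePart]
    congr 1
    ext x
    simp [eq_comm]
  rw [h]
  refine finrank_span_eq_card ?_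
  have := (Pi.basisFun ℂ (Fin n)).linearIndependent.comp (fun a : {a // p a = i} => a.1)
    Subtype.val_injective
  simpa [Function.comp_def] using this

/-- The table `(p, c, b)` has the invariant `B(e_s, ·) ∧ B(e_t, ·) ∧ B(e_l, ·)` if `B(e_i, e_j)` is
`b i j`; here `e_s` is even, and `e_t`, `e_l` have parity `q`. -/
structure IsTableFactorization (p : Fin n → ZMod 2) (c : Fin n → Fin n → Fin n → ℤ)
    (b : Fin n → Fin n → ℤ) (q : ZMod 2) (s t l : Fin n) : Prop where
  parity_even : p s = 0
  parity_left : p t = q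
  parity_right : p l = q
  form_bracket : ∀ i j k,
    ∑ m, c i j m * b m k = signedWedge (superSign q q) (b s) (b t) (b l) i j k

theorem IsTableFactorization.isFactorization_ofTable {q : ZMod 2} {s t l : Fin n}
    (h : IsTableFactorization p c b q s t l) (H : TableLaws p c b) :
    (ofTable p c r b H).IsFactorization q ((r : ℂ)⁻¹ ^ 2 • Pi.single s 1) (Pi.single t 1)
      (Pi.single l 1) where
  mem_even := Submodule.smul_mem _ _ (h.parity_even ▸ single_mem_tablePart p s)
  mem_left := h.parity_left ▸ single_mem_tablePart p t
  mem_right := h.parity_right ▸ single_mem_tablePart p l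
  form_bracket := by
    set T := ofTable p c r b H
    obtain ⟨τ, hτ⟩ := exists_trilinear_eq_signedWedge (superSign q q : ℂ)
      (T.form ((r : ℂ)⁻¹ ^ 2 • Pi.single s 1)) (T.form (Pi.single t 1)) (T.form (Pi.single l 1))
    suffices T.bracket.compr₂ T.form = τ from fun x y z => by rw [← hτ, ← this]; rfl
    refine table_ext fun i => table_ext fun j => table_ext fun k => ?_
    have hform (i j : Fin n) : T.form (Pi.single i 1) (Pi.single j 1) = r * (b i j : ℂ) :=
      tableForm_single r b i j
    have hbracket : T.bracket (Pi.single i 1) (Pi.single j 1) =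
        ∑ m, (c i j m : ℂ) • Pi.single m 1 := tableBracket_single c i j
    calc T.form (T.bracket (Pi.single i 1) (Pi.single j 1)) (Pi.single k 1)
        = r * ((∑ m, c i j m * b m k : ℤ) : ℂ) := by
          simp only [hbracket, map_sum, map_smul, LinearMap.sum_apply, LinearMap.smul_apply, hform,
            smul_eq_mul, Int.cast_sum, Int.cast_mul, Finset.mul_sum, mul_left_comm]
      _ = τ (Pi.single i 1) (Pi.single j 1) (Pi.single k 1) := by
          rw [h.form_bracket, hτ]
          simp only [signedWedge, map_smul, LinearMap.smul_apply, hform, smul_eq_mul, Int.cast_add,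
            Int.cast_sub, Int.cast_mul]
          field_simp

theorem IsTableFactorization.isFactorization_ofTable_one {q : ZMod 2} {s t l : Fin n}
    (h : IsTableFactorization p c b q s t l) (H : TableLaws p c b) :
    (ofTable p c 1 b H).IsFactorization q (Pi.single s 1) (Pi.single t 1) (Pi.single l 1) := by
  simpa using h.isFactorization_ofTable (r := 1) H

/-- In the table `c`, the vector `e_i` is the only basis vector whose bracket with a suitable `e_k`
has a component along a suitable `e_l`. Then all central vectors have `i`-th coordinate zero. -/
abbrev HasPivot (c : Fin n → Fin n → Fin n → ℤ) (i : Fin n) : Prop :=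
  ∃ k l, c i k l ≠ 0 ∧ ∀ m, m ≠ i → c m k l = 0

theorem HasPivot.apply_eq_zero {i : Fin n} (hi : HasPivot c i) {x : Fin n → ℂ}
    (hx : tableBracket c x = 0) : x i = 0 := by
  obtain ⟨k, l, hc, hc_ne⟩ := hi
  have h : tableBracket c x (Pi.single k 1) l = x i * c i k l := by
    simp only [tableBracket, LinearMap.mk₂_apply, Pi.single_apply, mul_ite, mul_one, mul_zero,
      ite_mul, zero_mul, Finset.sum_ite_eq', Finset.mem_univ, if_true]
    exact Finset.sum_eq_single i (fun m _ hm => by rw [hc_ne m hm]; simp) (by simp)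
  rw [hx] at h
  exact (mul_eq_zero.1 h.symm).resolve_right (Int.cast_ne_zero.2 hc)

theorem isReduced_ofTable [NeZero n] (H : TableLaws p c b)
    (hpivot : ∀ i j, b i j = 0 ∨ HasPivot c i ∨ HasPivot c j) : (ofTable p c r b H).IsReduced := by
  refine ⟨inferInstance, fun x hx y hy => ?_⟩
  change tableForm r b x y = 0
  rw [tableForm, LinearMap.mk₂_apply]
  refine Finset.sum_eq_zero fun i _ => Finset.sum_eq_zero fun j _ => ?_
  rcases hpivot i j with h | h | h
  · rw [h, Int.cast_zero, mul_zero, mul_zero]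
  · rw [h.apply_eq_zero hx, zero_mul, zero_mul]
  · rw [h.apply_eq_zero hy, mul_zero, zero_mul]

section Recognition

variable {V : Type*} [AddCommGroup V] [Module ℂ V] {g : QuadraticLieSuperalgebra V}

theorem linearCombination_mem_part {e : Fin n → V} (he : ∀ a, e a ∈ g.part (p a)) {i : ZMod 2} :
    ∀ x ∈ tablePart p i, Fintype.linearCombination ℂ e x ∈ g.part i := by
  change tablePart p i ≤ (g.part i).comap (Fintype.linearCombination ℂ e)
  refine Submodule.span_le.2 ?_
  rintro _ ⟨a, rfl, rfl⟩
  simpa [Fintype.linearCombination_apply_single] using he a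

theorem form_linearCombination {e : Fin n → V} (H : TableLaws p c b)
    (he : ∀ a, e a ∈ g.part (p a))
    (hform : ∀ i j, i ≤ j → p i = p j → g.form (e i) (e j) = r * b i j) (x y : Fin n → ℂ) :
    g.form (Fintype.linearCombination ℂ e x) (Fintype.linearCombination ℂ e y) =
      tableForm r b x y := by
  suffices g.form.compl₁₂ (Fintype.linearCombination ℂ e) (Fintype.linearCombination ℂ e) =
    tableForm r b by rw [← this, LinearMap.compl₁₂_apply]
  refine table_ext fun i => table_ext fun j => ?_
  simp only [LinearMap.compl₁₂_apply, Fintype.linearCombination_apply_single, one_smul,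
    tableForm_single]
  by_cases hp : p i = p j
  · rcases le_total i j with hij | hji
    · exact hform i j hij hp
    · rw [g.form_supersymm _ _ _ _ (he i) (he j), hform j i hji hp.symm, H.form_symm i j,
        zsmul_eq_mul, Int.cast_mul, mul_left_comm]
  · rw [g.form_eq_zero_of_ne hp (he i) (he j), not_ne_iff.1 (mt (H.form_even i j) hp),
      Int.cast_zero, mul_zero]

theorem IsReduced.iIsomorphic_ofTable (hg : g.IsReduced) {H : TableLaws p c b} {i : ZMod 2}
    {u v w : Fin n → ℂ} (h : (ofTable p c r b H).IsFactorization i u v w) {e : Fin n → V}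
    (he : ∀ a, e a ∈ g.part (p a))
    (hform : ∀ i j, i ≤ j → p i = p j → g.form (e i) (e j) = r * b i j)
    (hfac : g.IsFactorization i (Fintype.linearCombination ℂ e u) (Fintype.linearCombination ℂ e v)
      (Fintype.linearCombination ℂ e w)) :
    g.IIsomorphic (ofTable p c r b H) :=
  hg.iIsomorphic_of_isFactorization h hfac (fun _ => linearCombination_mem_part he)
    (form_linearCombination H he hform)

end Recognition

end Table

section Models

theorem isReduced_g3 (r : ℂˣ) : (g3 r).IsReduced := isReduced_ofTable _ (by decide +kernel)

theorem isReduced_g4 : g4.IsReduced := isReduced_ofTable _ (by decide +kernel)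

theorem isReduced_g5 : g5.IsReduced := isReduced_ofTable _ (by decide +kernel)

theorem isReduced_g6 : g6.IsReduced := isReduced_ofTable _ (by decide +kernel)

theorem isReduced_gs41 : gs41.IsReduced := isReduced_ofTable _ (by decide +kernel)

theorem isReduced_gs42 : gs42.IsReduced := isReduced_ofTable _ (by decide +kernel)

theorem isReduced_gs6 : gs6.IsReduced := isReduced_ofTable _ (by decide +kernel)

theorem isFactorization_g3 (r : ℂˣ) : (g3 r).IsFactorization 0
    ((r : ℂ)⁻¹ ^ 2 • Pi.single 0 1) (Pi.single 1 1) (Pi.single 2 1) :=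
  IsTableFactorization.isFactorization_ofTable (by constructor <;> decide +kernel) _

theorem isFactorization_g4 :
    g4.IsFactorization 0 (Pi.single 3 1) (Pi.single 2 1) (Pi.single 1 1) :=
  IsTableFactorization.isFactorization_ofTable_one (by constructor <;> decide +kernel) _

theorem isFactorization_g5 :
    g5.IsFactorization 0 (Pi.single 3 1) (Pi.single 4 1) (Pi.single 2 1) :=
  IsTableFactorization.isFactorization_ofTable_one (by constructor <;> decide +kernel) _

theorem isFactorization_g6 :
    g6.IsFactorization 0 (Pi.single 3 1) (Pi.single 4 1) (Pi.single 5 1) :=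
  IsTableFactorization.isFactorization_ofTable_one (by constructor <;> decide +kernel) _

theorem isFactorization_gs41 :
    gs41.IsFactorization 1 (Pi.single 0 1) (Pi.single 2 1) (Pi.single 2 1) :=
  IsTableFactorization.isFactorization_ofTable_one (by constructor <;> decide +kernel) _

theorem isFactorization_gs42 :
    gs42.IsFactorization 1 (Pi.single 0 1) (Pi.single 3 1) (Pi.single 2 1) :=
  IsTableFactorization.isFactorization_ofTable_one (by constructor <;> decide +kernel) _

theorem isFactorization_gs6 :
    gs6.IsFactorization 1 (Pi.single 0 1) (Pi.single 2 1) (Pi.single 3 1) :=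
  IsTableFactorization.isFactorization_ofTable_one (by constructor <;> decide +kernel) _

theorem LieModel.isReduced_algebra : ∀ m : LieModel, m.algebra.IsReduced
  | .g3 r => isReduced_g3 r
  | .g4 => isReduced_g4
  | .g5 => isReduced_g5
  | .g6 => isReduced_g6

theorem LieModel.exists_isFactorization :
    ∀ m : LieModel, ∃ u v w, m.algebra.IsFactorization 0 u v w
  | .g3 r => ⟨_, _, _, isFactorization_g3 r⟩
  | .g4 => ⟨_, _, _, isFactorization_g4⟩
  | .g5 => ⟨_, _, _, isFactorization_g5⟩
  | .g6 => ⟨_, _, _, isFactorization_g6⟩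

theorem SuperModel.isReduced_algebra : ∀ m : SuperModel, m.algebra.IsReduced
  | .gs41 => isReduced_gs41
  | .gs42 => isReduced_gs42
  | .gs6 => isReduced_gs6

theorem SuperModel.exists_isFactorization :
    ∀ m : SuperModel, ∃ u v w, m.algebra.IsFactorization 1 u v w
  | .gs41 => ⟨_, _, _, isFactorization_gs41⟩
  | .gs42 => ⟨_, _, _, isFactorization_gs42⟩
  | .gs6 => ⟨_, _, _, isFactorization_gs6⟩

theorem LieModel.part_one_eq_bot (m : LieModel) : m.algebra.part 1 = ⊥ :=
  have ⟨_, _, _, h⟩ := m.exists_isFactorization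
  h.part_one_eq_bot m.isReduced_algebra

theorem SuperModel.part_one_ne_bot (m : SuperModel) : m.algebra.part 1 ≠ ⊥ :=
  have ⟨_, _, _, h⟩ := m.exists_isFactorization
  h.part_one_ne_bot m.isReduced_algebra

theorem SuperModel.finrank_part_zero :
    ∀ m : SuperModel, Module.finrank ℂ (m.algebra.part 0) = 2
  | .gs41 => (finrank_tablePart _ 0).trans (by decide)
  | .gs42 => (finrank_tablePart _ 0).trans (by decide)
  | .gs6 => (finrank_tablePart _ 0).trans (by decide)

end Models

section Uniqueness

theorem bracket_g3 (r : ℂˣ) (x y : Fin 3 → ℂ) : (g3 r).bracket x y = crossProduct x y := by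
  suffices (g3 r).bracket = crossProduct by rw [this]
  refine table_ext fun i => table_ext fun j => ?_
  change tableBracket _ _ _ = _
  rw [tableBracket_single]
  fin_cases i <;> fin_cases j <;> ext k <;> fin_cases k <;>
    simp [Fin.sum_univ_three, tableBracketCoeff, cross_apply]

theorem form_g3 (r : ℂˣ) (x y : Fin 3 → ℂ) : (g3 r).form x y = r * (x ⬝ᵥ y) := by
  suffices (g3 r).form = (r : ℂ) • dotProductBilin ℂ ℂ by rw [this]; rfl
  refine table_ext fun i => table_ext fun j => (tableForm_single _ _ i j).trans ?_
  fin_cases i <;> fin_cases j <;> simp [tableFormCoeff]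

theorem eq_of_iIsomorphic_g3 {r s : ℂˣ} (h : (g3 r).IIsomorphic (g3 s)) : r = s := by
  obtain ⟨A, -, hbracket, hform⟩ := h
  have double_bracket (t : ℂˣ) (x y : Fin 3 → ℂ) :
      (t : ℂ) • (g3 t).bracket x ((g3 t).bracket x y) =
        (g3 t).form x y • x - (g3 t).form x x • y := by
    simp only [bracket_g3, form_g3, cross_cross_eq_smul_sub_smul', smul_sub, smul_smul]
  set x : Fin 3 → ℂ := ![1, 0, 0]
  set y : Fin 3 → ℂ := ![0, 1, 0]
  have hxy : (g3 r).form x y = 0 := by simp [form_g3, x, y]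
  have hxx : (g3 r).form x x = r := by simp [form_g3, x]
  have hbracket_r : (g3 r).bracket x ((g3 r).bracket x y) = -y :=
    smul_right_injective _ r.ne_zero <| by simp [double_bracket, hxy, hxx]
  have hbracket_s := double_bracket s (A x) (A y)
  rw [← hbracket, ← hbracket, hbracket_r, hform, hform, hxy, hxx, zero_smul, zero_sub, map_neg,
    smul_neg, neg_inj] at hbracket_s
  have hy : y ≠ 0 := fun h => one_ne_zero (congrFun h 1)
  exact Units.ext (smul_left_injective ℂ (A.map_ne_zero_iff.2 hy) hbracket_s).symm

theorem bracket_bracket_gs41 (x y z : Fin 4 → ℂ) : gs41.bracket x (gs41.bracket y z) = 0 := by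
  have hform (i j : Fin 4) : gs41.form (Pi.single i 1) (Pi.single j 1) =
      tableFormCoeff ![0, 0, 1, 1] [(0, 1), (2, 3)] i j :=
    (tableForm_single _ _ i j).trans (by simp)
  have hX₀ : gs41.form (Pi.single 0 1) (gs41.bracket y z) = 0 := by
    simp [isFactorization_gs41.bracket_eq, hform, tableFormCoeff]
  have hX₁ : gs41.form (Pi.single 2 1) (gs41.bracket y z) = 0 := by
    simp [isFactorization_gs41.bracket_eq, hform, tableFormCoeff]
  simp [isFactorization_gs41.bracket_eq x, hX₀, hX₁]

theorem not_iIsomorphic_gs41_gs42 : ¬ gs41.IIsomorphic gs42 := by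
  rintro ⟨A, -, hbracket, -⟩
  have hY₀X₁ : gs42.bracket (Pi.single 1 1) (Pi.single 2 1) = Pi.single 2 1 :=
    (tableBracket_single _ _ _).trans (by simp [tableBracketCoeff])
  obtain ⟨x, hx⟩ := A.surjective (Pi.single 1 1)
  obtain ⟨y, hy⟩ := A.surjective (Pi.single 2 1)
  have h : A (gs41.bracket x (gs41.bracket x y)) = Pi.single 2 1 := by
    rw [hbracket, hbracket, hx, hy, hY₀X₁, hY₀X₁]
  rw [bracket_bracket_gs41, map_zero] at h
  exact zero_ne_one (congrFun h 2)

theorem LieModel.eq_of_iIsomorphic {m m' : LieModel} (h : m.algebra.IIsomorphic m'.algebra) :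
    m = m' := by
  have hdim : m.dim = m'.dim := by simpa using h.finrank_eq
  cases m <;> cases m' <;> simp only [LieModel.dim, Nat.reduceEqDiff] at hdim <;> try rfl
  exact congrArg LieModel.g3 (eq_of_iIsomorphic_g3 h)

theorem SuperModel.eq_of_iIsomorphic {m m' : SuperModel} (h : m.algebra.IIsomorphic m'.algebra) :
    m = m' := by
  have hdim : m.dim = m'.dim := by simpa using h.finrank_eq
  cases m <;> cases m' <;> simp only [SuperModel.dim, Nat.reduceEqDiff] at hdim <;> try rfl
  · exact absurd h not_iIsomorphic_gs41_gs42
  · exact absurd h.symm not_iIsomorphic_gs41_gs42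

theorem IsModelledBy.unique {V : Type*} [AddCommGroup V] [Module ℂ V]
    {g : QuadraticLieSuperalgebra V} : ∀ {m m' : LieModel ⊕ SuperModel},
      g.IsModelledBy m → g.IsModelledBy m' → m = m'
  | .inl _, .inl _, h, h' => congrArg Sum.inl (LieModel.eq_of_iIsomorphic (h.symm.trans h'))
  | .inr _, .inr _, h, h' => congrArg Sum.inr (SuperModel.eq_of_iIsomorphic (h.symm.trans h'))
  | .inl m, .inr m', h, h' =>
      absurd ((h.symm.trans h').part_eq_bot m.part_one_eq_bot) m'.part_one_ne_bot
  | .inr m, .inl m', h, h' =>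
      absurd ((h'.symm.trans h).part_eq_bot m'.part_one_eq_bot) m.part_one_ne_bot

end Uniqueness

variable {V : Type*} [AddCommGroup V] [Module ℂ V] {g : QuadraticLieSuperalgebra V}

theorem exists_isotropic_dual_family {ι : Type*} [Finite ι] [DecidableEq ι] {i : ZMod 2}
    {z x : ι → V} (hz : ∀ k, z k ∈ g.part i) (hzz : ∀ j k, g.form (z j) (z k) = 0)
    (hzx : ∀ j k, g.form (z j) (x k) = if j = k then 1 else 0) :
    ∃ y : ι → V, (∀ k, y k ∈ g.part i) ∧ (∀ j k, g.form (y j) (y k) = 0) ∧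
      ∀ w ∈ g.part i, (∀ k, g.form w (z k) = 0) → ∀ k, g.form w (y k) = g.form w (x k) := by
  cases nonempty_fintype ι
  choose x' hx' x'' hx'' hx using fun k => g.exists_add_eq i (x k)
  have hform {w : V} (hw : w ∈ g.part i) (k : ι) : g.form w (x' k) = g.form w (x k) := by
    rw [← hx k, map_add, g.form_eq_zero_of_ne (ZModTwo.ne_add_one i) hw (hx'' k), add_zero]
  refine ⟨isotropicCorrection g.form z x', isotropicCorrection_mem hz hx',
    isotropicCorrection_apply_self two_ne_zero hzz (fun j k => ?_)
      (fun j k => g.form_comm (hx' j) (z k)) (fun j k => g.form_comm (hx' j) (x' k)),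
    fun w hw hwz k => ?_⟩
  · rw [hform (hz j), hzx]
  · rw [apply_isotropicCorrection hwz, hform hw]

theorem exists_isotropic_form_eq_one [FiniteDimensional ℂ V] {i : ZMod 2} {z : V}
    (hz : z ∈ g.part i) (hz0 : z ≠ 0) (hzz : g.form z z = 0) :
    ∃ y ∈ g.part i, g.form z y = 1 ∧ g.form y y = 0 := by
  obtain ⟨x, hx⟩ := exists_dual_family g.form_nondegenerate (v := fun _ : Unit => z)
    (.of_subsingleton () hz0)
  obtain ⟨y, hy, hyy, hzy⟩ := exists_isotropic_dual_family (fun _ => hz) (fun _ _ => hzz) hx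
  exact ⟨y (), hy (), by rw [hzy z hz (fun _ => hzz), hx () (), if_pos rfl], hyy () ()⟩

namespace IsFactorization

variable {a b c : V}

theorem swap (h : g.IsFactorization 1 a b c) : g.IsFactorization 1 a c b where
  mem_even := h.mem_even
  mem_left := h.mem_right
  mem_right := h.mem_left
  form_bracket x y z := by
    rw [h.form_bracket, superSign_one_one]
    simp only [signedWedge]
    push_cast
    ring

theorem exists_odd_form_ne_zero (h : g.IsFactorization 1 a b c) (hg : g.IsReduced) :
    ∃ y ∈ g.part 1, g.form b y ≠ 0 ∧ g.form c y ≠ 0 := by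
  have exists_form_ne {x : V} (hx : x ∈ g.part 1) (hx0 : x ≠ 0) :
      ∃ y ∈ g.part 1, g.form x y ≠ 0 := by
    by_contra! h0
    exact hx0 <| Submodule.disjoint_def.1 g.isCompl_part.disjoint x
      (g.mem_part_of_form_eq_zero (i := 0) h0) hx
  obtain ⟨y, hy, hbc⟩ := Module.Dual.exists_forall_mem_ne_zero_of_forall_exists (g.part 1)
    ![g.form b, g.form c] (Fin.forall_fin_two.2
      ⟨exists_form_ne h.mem_left (h.ne_zero_left hg),
        exists_form_ne h.mem_right (h.swap.ne_zero_left hg)⟩)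
  exact ⟨y, hy, hbc 0, hbc 1⟩

end IsFactorization

theorem bracket_bracket_self_odd {y : V} (hy : y ∈ g.part 1) :
    g.bracket (g.bracket y y) y = 0 := by
  have hskew := g.bracket_skew (1 + 1) 1 _ y (g.bracket_mem 1 1 y y hy hy) hy
  rw [show superSign (1 + 1) 1 = 1 from rfl, one_smul] at hskew
  have hjacobi := g.jacobi 1 1 y y y hy hy
  rw [superSign_one_one, neg_one_smul, hskew] at hjacobi
  have h3 : (3 : ℂ) • g.bracket y (g.bracket y y) = 0 := by
    linear_combination (norm := module) hjacobi
  rw [hskew, (smul_eq_zero_iff_right three_ne_zero).1 h3, neg_zero]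

theorem IsFactorization.form_self_eq_zero {a b c : V} (h : g.IsFactorization 1 a b c)
    (hg : g.IsReduced) : g.form a a = 0 := by
  obtain ⟨y, hy, hby, hcy⟩ := h.exists_odd_form_ne_zero hg
  have hay : g.form a y = 0 := g.form_even a y h.mem_even hy
  have hbracket_self : g.bracket y y = (-2 * g.form b y * g.form c y) • a := by
    rw [h.bracket_eq, hay, superSign_one_one]
    push_cast
    module
  have hbracket : g.bracket a y = 0 := by
    have := bracket_bracket_self_odd hy
    rw [hbracket_self, map_smul, LinearMap.smul_apply, smul_eq_zero] at this
    exact this.resolve_left (by simp [hby, hcy])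
  have hform : -2 * (g.form a a * g.form b y * g.form c y) = 0 := by
    calc _ = g.form (g.bracket a y) y := by
          rw [h.form_bracket, signedWedge, hay, superSign_one_one]
          push_cast
          ring
      _ = 0 := by rw [hbracket, map_zero, LinearMap.zero_apply]
  simpa [hby, hcy] using hform

section Super

variable [FiniteDimensional ℂ V] {a b c : V}

theorem IsFactorization.exists_even_isotropic (h : g.IsFactorization 1 a b c) (hg : g.IsReduced) :
    ∃ y ∈ g.part 0, g.form a y = 1 ∧ g.form y y = 0 :=
  exists_isotropic_form_eq_one h.mem_even (h.ne_zero_even hg) (h.form_self_eq_zero hg)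

theorem IsReduced.iIsomorphic_gs41 (hg : g.IsReduced) (h : g.IsFactorization 1 a b b) :
    g.IIsomorphic gs41 := by
  obtain ⟨y, hy, hay, hyy⟩ := h.exists_even_isotropic hg
  obtain ⟨z, hz, hbz, -⟩ := exists_isotropic_form_eq_one h.mem_left (h.ne_zero_left hg)
    (g.form_self_odd h.mem_left)
  refine hg.iIsomorphic_ofTable isFactorization_gs41 (e := ![a, y, b, z]) ?_ ?_ ?_
  · simp [Fin.forall_fin_succ, h.mem_even, h.mem_left, hy, hz]
  · simp [Fin.forall_fin_succ, tableFormCoeff, hay, hyy, hbz, h.form_self_eq_zero hg,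
      g.form_self_odd h.mem_left, g.form_self_odd hz]
  · simpa [Fintype.linearCombination_apply_single] using h

theorem IsReduced.iIsomorphic_gs42 (hg : g.IsReduced) (h : g.IsFactorization 1 a b c)
    (hcb : g.form c b = 1) : g.IIsomorphic gs42 := by
  obtain ⟨y, hy, hay, hyy⟩ := h.exists_even_isotropic hg
  refine hg.iIsomorphic_ofTable isFactorization_gs42 (e := ![a, y, c, b]) ?_ ?_ ?_
  · simp [Fin.forall_fin_succ, h.mem_even, h.mem_left, h.mem_right, hy]
  · simp [Fin.forall_fin_succ, tableFormCoeff, hay, hyy, hcb, h.form_self_eq_zero hg,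
      g.form_self_odd h.mem_left, g.form_self_odd h.mem_right]
  · simpa [Fintype.linearCombination_apply_single] using h

theorem IsReduced.iIsomorphic_gs6 (hg : g.IsReduced) (h : g.IsFactorization 1 a b c)
    (hbc : LinearIndependent ℂ ![b, c]) (hcb : g.form c b = 0) : g.IIsomorphic gs6 := by
  have hbb := g.form_self_odd h.mem_left
  have hcc := g.form_self_odd h.mem_right
  have hbc0 : g.form b c = 0 := by rw [g.form_comm_odd h.mem_left, hcb, neg_zero]
  obtain ⟨y, hy, hay, hyy⟩ := h.exists_even_isotropic hg
  obtain ⟨x, hx⟩ := exists_dual_family g.form_nondegenerate hbc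
  obtain ⟨z, hz, hzz, hform⟩ := exists_isotropic_dual_family (i := 1)
    (by simp [Fin.forall_fin_two, h.mem_left, h.mem_right])
    (by simp [Fin.forall_fin_two, hbb, hcc, hcb, hbc0]) hx
  have hbz (k) : g.form b (z k) = if 0 = k then 1 else 0 :=
    (hform b h.mem_left (by simp [Fin.forall_fin_two, hbb, hbc0]) k).trans (hx 0 k)
  have hcz (k) : g.form c (z k) = if 1 = k then 1 else 0 :=
    (hform c h.mem_right (by simp [Fin.forall_fin_two, hcc, hcb]) k).trans (hx 1 k)
  refine hg.iIsomorphic_ofTable isFactorization_gs6 (e := ![a, y, b, c, z 0, z 1]) ?_ ?_ ?_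
  · simp [Fin.forall_fin_succ, h.mem_even, h.mem_left, h.mem_right, hy, hz]
  · simp [Fin.forall_fin_succ, tableFormCoeff, hay, hyy, hbb, hcc, hbc0, hbz, hcz, hzz,
      h.form_self_eq_zero hg]
  · simpa [Fintype.linearCombination_apply_single] using h

theorem IsReduced.exists_iIsomorphic_superModel (hg : g.IsReduced)
    (h : g.IsFactorization 1 a b c) : ∃ m : SuperModel, g.IIsomorphic m.algebra := by
  by_cases hcb : g.form c b = 0
  · by_cases hbc : LinearIndependent ℂ ![b, c]
    · exact ⟨.gs6, hg.iIsomorphic_gs6 h hbc hcb⟩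
    · rw [LinearIndependent.pair_iff' (h.ne_zero_left hg)] at hbc
      push Not at hbc
      obtain ⟨k, rfl⟩ := hbc
      have hk : k ≠ 0 := by
        rintro rfl
        exact h.swap.ne_zero_left hg (zero_smul ℂ b)
      refine ⟨.gs41, hg.iIsomorphic_gs41 (a := k • a) (b := b) ?_⟩
      simpa [hk] using h.smul (a := k) (b := 1) (c := k⁻¹) (by field_simp)
  · refine ⟨.gs42, hg.iIsomorphic_gs42
      (h.smul (a := g.form c b) (b := (g.form c b)⁻¹) (c := 1) (by field_simp)) ?_⟩
    simp [hcb]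

end Super

end QuadraticLieSuperalgebra

theorem exists_det_ne_zero_and_orthogonal {K : Type*} [Field K] [Invertible (2 : K)] {n : ℕ}
    {B : LinearMap.BilinForm K (Fin n → K)} (hB : LinearMap.IsSymm B) :
    ∃ P : Matrix (Fin n) (Fin n) K, P.det ≠ 0 ∧ ∀ {i j}, i ≠ j → B (P i) (P j) = 0 := by
  obtain ⟨b₀, hb₀⟩ := LinearMap.BilinForm.exists_orthogonal_basis hB
  obtain ⟨b, hb⟩ : ∃ b : Module.Basis (Fin n) K (Fin n → K), ∀ {i j}, i ≠ j → B (b i) (b j) = 0 :=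
    have e := finCongr (Module.finrank_fin_fun K (n := n))
    ⟨b₀.reindex e, fun hij => by simpa using hb₀ (e.symm.injective.ne hij)⟩
  refine ⟨Matrix.of b, ?_, hb⟩
  rw [← Pi.basisFun_det_apply]
  exact ((Pi.basisFun K (Fin n)).isUnit_det b).ne_zero

namespace QuadraticLieSuperalgebra

variable {V : Type*} [AddCommGroup V] [Module ℂ V] {g : QuadraticLieSuperalgebra V} {u v w : V}

namespace IsFactorization

theorem linearCombination_mem (h : g.IsFactorization 0 u v w) (t : Fin 3 → ℂ) :
    Fintype.linearCombination ℂ ![u, v, w] t ∈ g.part 0 := by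
  rw [Fintype.linearCombination_apply]
  refine (g.part 0).sum_mem fun k _ => (g.part 0).smul_mem _ ?_
  fin_cases k
  exacts [h.mem_even, h.mem_left, h.mem_right]

theorem linearCombination (h : g.IsFactorization 0 u v w) {P : Matrix (Fin 3) (Fin 3) ℂ}
    (hP : P.det ≠ 0) :
    g.IsFactorization 0 (P.det⁻¹ • Fintype.linearCombination ℂ ![u, v, w] (P 0))
      (Fintype.linearCombination ℂ ![u, v, w] (P 1))
      (Fintype.linearCombination ℂ ![u, v, w] (P 2)) where
  mem_even := (g.part 0).smul_mem _ (h.linearCombination_mem _)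
  mem_left := h.linearCombination_mem _
  mem_right := h.linearCombination_mem _
  form_bracket x y z := by
    let α (j : Fin 3) : V → ℂ := g.form (![u, v, w] j)
    have hα (t : Fin 3 → ℂ) : ⇑(g.form (Fintype.linearCombination ℂ ![u, v, w] t)) =
        ∑ j, t j • α j := by
      simp [α, Fintype.linearCombination_apply, LinearMap.coe_sum]
    have hsmul := signedWedge_smul 1 P.det⁻¹ 1 1 (∑ j, P 0 j • α j) (∑ j, P 1 j • α j)
      (∑ j, P 2 j • α j) x y z
    rw [signedWedge_one_sum_smul, one_smul, one_smul, mul_one, mul_one,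
      inv_mul_cancel_left₀ hP] at hsmul
    rw [h.form_bracket, superSign_zero_left, Int.cast_one, map_smul, LinearMap.coe_smul, hα, hα, hα,
      hsmul]
    rfl

end IsFactorization

/-- A factorization of the invariant of a quadratic Lie algebra by pairwise orthogonal vectors. -/
structure IsOrthogonalFactorization (g : QuadraticLieSuperalgebra V) (u v w : V) : Prop extends
    g.IsFactorization 0 u v w where
  form_even_left : g.form u v = 0
  form_even_right : g.form u w = 0
  form_left_right : g.form v w = 0

theorem IsFactorization.exists_isOrthogonalFactorization (h : g.IsFactorization 0 u v w) :
    ∃ u' v' w', g.IsOrthogonalFactorization u' v' w' := by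
  let φ := Fintype.linearCombination ℂ ![u, v, w]
  obtain ⟨P, hP, horthogonal⟩ := exists_det_ne_zero_and_orthogonal (B := g.form.compl₁₂ φ φ)
    ⟨fun s t => g.form_comm_even (h.linearCombination_mem s) (φ t)⟩
  refine ⟨_, _, _, h.linearCombination hP, ?_, ?_, horthogonal (by decide)⟩
  · simpa using .inr (horthogonal (i := 0) (j := 1) (by decide))
  · simpa using .inr (horthogonal (i := 0) (j := 2) (by decide))

namespace IsOrthogonalFactorization

theorem smul (h : g.IsOrthogonalFactorization u v w) {a b c : ℂ}
    (habc : a * b * c = 1) : g.IsOrthogonalFactorization (a • u) (b • v) (c • w) where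
  toIsFactorization := h.toIsFactorization.smul habc
  form_even_left := by simp [h.form_even_left]
  form_even_right := by simp [h.form_even_right]
  form_left_right := by simp [h.form_left_right]

theorem form_left_even (h : g.IsOrthogonalFactorization u v w) : g.form v u = 0 := by
  rw [g.form_comm_even h.mem_left, h.form_even_left]

theorem form_right_even (h : g.IsOrthogonalFactorization u v w) : g.form w u = 0 := by
  rw [g.form_comm_even h.mem_right, h.form_even_right]

theorem form_right_left (h : g.IsOrthogonalFactorization u v w) : g.form w v = 0 := by
  rw [g.form_comm_even h.mem_right, h.form_left_right]

theorem rotate (h : g.IsOrthogonalFactorization u v w) :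
    g.IsOrthogonalFactorization v w u where
  toIsFactorization := h.toIsFactorization.rotate
  form_even_left := h.form_left_right
  form_even_right := h.form_left_even
  form_left_right := h.form_right_even

end IsOrthogonalFactorization

end QuadraticLieSuperalgebra

theorem exists_ne_zero_mul_self_mul_eq_one {K : Type*} [Field K] [IsAlgClosed K] {d : K}
    (hd : d ≠ 0) : ∃ s : K, s ≠ 0 ∧ s * s * d = 1 := by
  obtain ⟨s, hs⟩ := IsAlgClosed.exists_eq_mul_self d⁻¹
  refine ⟨s, ?_, by rw [← hs, inv_mul_cancel₀ hd]⟩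
  rintro rfl
  simp [hd] at hs

namespace QuadraticLieSuperalgebra

variable {V : Type*} [AddCommGroup V] [Module ℂ V] {g : QuadraticLieSuperalgebra V}

namespace IsOrthogonalFactorization

variable {u v w : V}

theorem exists_iIsomorphic_g3 (h : g.IsOrthogonalFactorization u v w) (hg : g.IsReduced)
    (huu : g.form u u ≠ 0) (hvv : g.form v v ≠ 0) (hww : g.form w w ≠ 0) :
    ∃ r, g.IIsomorphic (g3 r) := by
  obtain ⟨a, ha, hau⟩ := exists_ne_zero_mul_self_mul_eq_one huu
  obtain ⟨b, hb, hbv⟩ := exists_ne_zero_mul_self_mul_eq_one hvv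
  obtain ⟨c, hc, hcw⟩ := exists_ne_zero_mul_self_mul_eq_one hww
  obtain ⟨s, hs⟩ : ∃ s, s = a * b * c := ⟨_, rfl⟩
  have hs0 : s ≠ 0 := by simp [hs, ha, hb, hc]
  refine ⟨Units.mk0 (s ^ 2) (pow_ne_zero 2 hs0), hg.iIsomorphic_ofTable (isFactorization_g3 _)
    (e := ![(s * a) • u, (s * b) • v, (s * c) • w]) ?_ ?_ ?_⟩
  · simp [Fin.forall_fin_succ, Submodule.smul_mem, h.mem_even, h.mem_left, h.mem_right]
  · suffices s * a * (s * a * g.form u u) = s ^ 2 ∧ s * b * (s * b * g.form v v) = s ^ 2 ∧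
        s * c * (s * c * g.form w w) = s ^ 2 by
      simpa [Fin.forall_fin_succ, tableFormCoeff, h.form_even_left, h.form_even_right,
        h.form_left_right] using this
    exact ⟨by linear_combination s ^ 2 * hau, by linear_combination s ^ 2 * hbv,
      by linear_combination s ^ 2 * hcw⟩
  · have hscale : (s ^ 2)⁻¹ ^ 2 * (s * a) * (s * b) * (s * c) = 1 := by
      field_simp
      rw [hs]
    simpa [Fintype.linearCombination_apply_single, smul_smul] using h.toIsFactorization.smul hscale

end IsOrthogonalFactorization

variable [FiniteDimensional ℂ V]

theorem IsFactorization.exists_isotropic_dual_family {ι : Type*} {u v w : V}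
    (h : g.IsFactorization 0 u v w) (hg : g.IsReduced) {σ : ι → Fin 3} (hσ : σ.Injective)
    (horthogonal : ∀ j k, g.form (![u, v, w] k) (![u, v, w] (σ j)) = 0) :
    ∃ x : ι → V, (∀ j, x j ∈ g.part 0) ∧ (∀ j k, g.form (x j) (x k) = 0) ∧
      ∀ j k, g.form (x j) (![u, v, w] k) = if k = σ j then 1 else 0 := by
  classical
  have := Finite.of_injective σ hσ
  obtain ⟨d, hd⟩ := h.exists_dual_family hg
  have hmem : ∀ k, ![u, v, w] k ∈ g.part 0 := by
    simp [Fin.forall_fin_succ, h.mem_even, h.mem_left, h.mem_right]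
  obtain ⟨x, hx, hxx, hform⟩ := QuadraticLieSuperalgebra.exists_isotropic_dual_family
    (z := fun j => ![u, v, w] (σ j)) (x := fun j => d (σ j)) (fun j => hmem (σ j))
    (fun j k => horthogonal k (σ j)) (fun j k => by simp [hd, hσ.eq_iff])
  refine ⟨x, hx, hxx, fun j k => ?_⟩
  rw [g.form_comm_even (hx j), hform _ (hmem k) fun i => horthogonal i k, hd]

theorem IsReduced.iIsomorphic_g4 {p q z : V} (hg : g.IsReduced) (h : g.IsFactorization 0 z q p)
    (hzz : g.form z z = 0) (hqz : g.form q z = 0) (hpz : g.form p z = 0) (hqq : g.form q q = 0)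
    (hpp : g.form p p = 0) (hpq : g.form p q = 1) : g.IIsomorphic g4 := by
  obtain ⟨x, hx, hxx, hform⟩ := h.exists_isotropic_dual_family hg
    (Function.injective_of_subsingleton fun _ : Unit => 0)
    (by simp [Fin.forall_fin_succ, hzz, hqz, hpz])
  obtain ⟨hxz, hxq, hxp⟩ : g.form (x ()) z = 1 ∧ g.form (x ()) q = 0 ∧ g.form (x ()) p = 0 :=
    ⟨hform () 0, hform () 1, hform () 2⟩
  refine hg.iIsomorphic_ofTable isFactorization_g4 (e := ![x (), p, q, z]) ?_ ?_ ?_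
  · simp [Fin.forall_fin_succ, h.mem_even, h.mem_left, h.mem_right, hx]
  · simp [Fin.forall_fin_succ, tableFormCoeff, hxx, hxz, hxq, hxp, hpp, hpq, hpz, hqq, hqz, hzz]
  · simpa [Fintype.linearCombination_apply_single] using h

namespace IsOrthogonalFactorization

variable {u v w : V}

theorem iIsomorphic_g4_of_form_self_eq_one (h : g.IsOrthogonalFactorization u v w)
    (hg : g.IsReduced) (huu : g.form u u = 0) (hvv : g.form v v = 1) (hww : g.form w w = 1) :
    g.IIsomorphic g4 := by
  have hI := Complex.I_mul_I
  have hfac : g.IsFactorization 0 ((-Complex.I) • u) ((2⁻¹ : ℂ) • v - (Complex.I / 2) • w)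
      (v + Complex.I • w) := by
    have hdet : (!![1, 0, 0; 0, 2⁻¹, -(Complex.I / 2); 0, 1, Complex.I]).det = Complex.I := by
      simp only [Matrix.det_fin_three, Matrix.of_apply, Matrix.cons_val]
      ring
    have := h.toIsFactorization.linearCombination (hdet.trans_ne Complex.I_ne_zero)
    rw [hdet] at this
    simpa [Fintype.linearCombination_apply, Fin.sum_univ_three, sub_eq_add_neg] using this
  refine hg.iIsomorphic_g4 hfac ?_ ?_ ?_ ?_ ?_ ?_ <;>
    simp only [map_add, map_sub, map_smul, LinearMap.add_apply, LinearMap.sub_apply,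
      LinearMap.smul_apply, smul_eq_mul, huu, hvv, hww, h.form_left_right, h.form_left_even,
      h.form_right_even, h.form_right_left] <;>
    grind

theorem iIsomorphic_g4 (h : g.IsOrthogonalFactorization u v w) (hg : g.IsReduced)
    (huu : g.form u u = 0) (hvv : g.form v v ≠ 0) (hww : g.form w w ≠ 0) :
    g.IIsomorphic g4 := by
  obtain ⟨b, hb, hbv⟩ := exists_ne_zero_mul_self_mul_eq_one hvv
  obtain ⟨c, hc, hcw⟩ := exists_ne_zero_mul_self_mul_eq_one hww
  refine (h.smul (a := (b * c)⁻¹) (b := b) (c := c) (by field_simp))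
    |>.iIsomorphic_g4_of_form_self_eq_one hg ?_ ?_ ?_
  · simp [huu]
  · simpa [mul_assoc] using hbv
  · simpa [mul_assoc] using hcw

theorem iIsomorphic_g5_of_form_self_eq_one (h : g.IsOrthogonalFactorization u v w)
    (hg : g.IsReduced) (huu : g.form u u = 0) (hvv : g.form v v = 0) (hww : g.form w w = 1) :
    g.IIsomorphic g5 := by
  obtain ⟨x, hx, hxx, hform⟩ := h.exists_isotropic_dual_family hg (Fin.castSucc_injective 2)
    (by simp [Fin.forall_fin_succ, huu, hvv, h.form_even_left, h.form_left_even,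
      h.form_right_even, h.form_right_left])
  have hxu (j) : g.form (x j) u = if 0 = j.castSucc then 1 else 0 := hform j 0
  have hxv (j) : g.form (x j) v = if 1 = j.castSucc then 1 else 0 := hform j 1
  have hxw (j) : g.form (x j) w = if 2 = j.castSucc then 1 else 0 := hform j 2
  refine hg.iIsomorphic_ofTable isFactorization_g5 (e := ![x 0, x 1, w, u, v]) ?_ ?_ ?_
  · simp [Fin.forall_fin_succ, h.mem_even, h.mem_left, h.mem_right, hx]
  · simp [Fin.forall_fin_succ, tableFormCoeff, hxx, hxu, hxv, hxw, huu, hvv, hww,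
      h.form_even_left, h.form_right_even, h.form_right_left]
  · simpa [Fintype.linearCombination_apply_single] using h.toIsFactorization

theorem iIsomorphic_g5 (h : g.IsOrthogonalFactorization u v w) (hg : g.IsReduced)
    (huu : g.form u u = 0) (hvv : g.form v v = 0) (hww : g.form w w ≠ 0) :
    g.IIsomorphic g5 := by
  obtain ⟨c, hc, hcw⟩ := exists_ne_zero_mul_self_mul_eq_one hww
  refine (h.smul (a := c⁻¹) (b := 1) (c := c) (by field_simp))
    |>.iIsomorphic_g5_of_form_self_eq_one hg ?_ ?_ ?_
  · simp [huu]
  · simp [hvv]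
  · simpa [mul_assoc] using hcw

theorem iIsomorphic_g6 (h : g.IsOrthogonalFactorization u v w) (hg : g.IsReduced)
    (huu : g.form u u = 0) (hvv : g.form v v = 0) (hww : g.form w w = 0) :
    g.IIsomorphic g6 := by
  obtain ⟨x, hx, hxx, hform⟩ := h.exists_isotropic_dual_family hg Function.injective_id
    (by simp [Fin.forall_fin_succ, huu, hvv, hww, h.form_even_left, h.form_even_right,
      h.form_left_right, h.form_left_even, h.form_right_even, h.form_right_left])
  have hxu (j) : g.form (x j) u = if 0 = j then 1 else 0 := hform j 0
  have hxv (j) : g.form (x j) v = if 1 = j then 1 else 0 := hform j 1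
  have hxw (j) : g.form (x j) w = if 2 = j then 1 else 0 := hform j 2
  refine hg.iIsomorphic_ofTable isFactorization_g6 (e := ![x 0, x 1, x 2, u, v, w]) ?_ ?_ ?_
  · simp [Fin.forall_fin_succ, h.mem_even, h.mem_left, h.mem_right, hx]
  · simp [Fin.forall_fin_succ, tableFormCoeff, hxx, hxu, hxv, hxw, huu, hvv, hww,
      h.form_even_left, h.form_even_right, h.form_left_right]
  · simpa [Fintype.linearCombination_apply_single] using h.toIsFactorization

end IsOrthogonalFactorization

theorem IsReduced.exists_iIsomorphic_lieModel {u v w : V} (hg : g.IsReduced)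
    (h : g.IsFactorization 0 u v w) : ∃ m : LieModel, g.IIsomorphic m.algebra := by
  obtain ⟨u, v, w, h⟩ := h.exists_isOrthogonalFactorization
  by_cases huu : g.form u u = 0 <;> by_cases hvv : g.form v v = 0 <;>
    by_cases hww : g.form w w = 0
  · exact ⟨.g6, h.iIsomorphic_g6 hg huu hvv hww⟩
  · exact ⟨.g5, h.iIsomorphic_g5 hg huu hvv hww⟩
  · exact ⟨.g5, h.rotate.rotate.iIsomorphic_g5 hg hww huu hvv⟩
  · exact ⟨.g4, h.iIsomorphic_g4 hg huu hvv hww⟩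
  · exact ⟨.g5, h.rotate.iIsomorphic_g5 hg hvv hww huu⟩
  · exact ⟨.g4, h.rotate.iIsomorphic_g4 hg hvv hww huu⟩
  · exact ⟨.g4, h.rotate.rotate.iIsomorphic_g4 hg hww huu hvv⟩
  · obtain ⟨r, hr⟩ := h.exists_iIsomorphic_g3 hg huu hvv hww
    exact ⟨.g3 r, hr⟩

theorem IsReduced.exists_isModelledBy (hg : g.IsReduced) (he : g.IsElementary) :
    ∃ m, g.IsModelledBy m := by
  obtain ⟨i, u, v, w, h⟩ := he.exists_isFactorization
  rcases ZModTwo.eq_zero_or_eq_one i with rfl | rfl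
  · obtain ⟨m, hm⟩ := hg.exists_iIsomorphic_lieModel h
    exact ⟨.inl m, hm⟩
  · obtain ⟨m, hm⟩ := hg.exists_iIsomorphic_superModel h
    exact ⟨.inr m, hm⟩

end QuadraticLieSuperalgebra

theorem proposition3p3p3 :
    (∀ m : QuadraticLieSuperalgebra.LieModel, m.algebra.IsReduced ∧ m.algebra.IsElementary ∧
      m.algebra.IsSingularS3 ∧ m.algebra.part 1 = ⊥) ∧
    (∀ m : QuadraticLieSuperalgebra.SuperModel, m.algebra.IsReduced ∧ m.algebra.IsElementary ∧
      Module.finrank ℂ (m.algebra.part 0) = 2) ∧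
    (∀ (V : Type*) [AddCommGroup V] [Module ℂ V] [FiniteDimensional ℂ V]
      (g : QuadraticLieSuperalgebra V), g.IsReduced → g.IsElementary →
      ∃! m : QuadraticLieSuperalgebra.LieModel ⊕ QuadraticLieSuperalgebra.SuperModel,
        g.IsModelledBy m) := by
  refine ⟨fun m => ?_, fun m => ?_, fun V _ _ _ g hg he => ?_⟩
  · obtain ⟨u, v, w, h⟩ := m.exists_isFactorization
    exact ⟨m.isReduced_algebra, h.isElementary, h.isSingularS3 m.isReduced_algebra,
      m.part_one_eq_bot⟩
  · obtain ⟨u, v, w, h⟩ := m.exists_isFactorization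
    exact ⟨m.isReduced_algebra, h.isElementary, m.finrank_part_zero⟩
  · obtain ⟨m, hm⟩ := hg.exists_isModelledBy he
    exact ⟨m, hm, fun m' hm' => hm'.unique hm⟩
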